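/- All graphs are finite, simple and undirected. A graph is matchable if it has a perfect matching (the graph without vertices is matchable); a connected graph is matching covered if each of its edges belongs to a perfect matching. A matchable graph $G$ is a Birkhoff-von Neumann graph (BN-graph) if its perfect matching polytope, that is, the convex hull in $\mathbb{R}^{E(G)}$ of the incidence vectors of the perfect matchings of $G$, equals $$\{x\in\mathbb{R}^{E(G)} : x\ge 0,\ x(\partial(v))=1 \text{ for each } v\in V(G)\},$$ where $x(\partial(v))$ is the sum of $x_e$ over the edges $e$ incident with $v$. A bisubdivision of a graph $J$ is a graph obtained from $J$ by replacing each edge in some (possibly empty) set of edges by a path of odd length with the same ends, these paths being internally disjoint. A subgraph $H$ of a matchable graph $G$ is conformal if $G-V(H)$ is matchable, and $J$ is a conformal minor of $G$ if some conformal subgraph of $G$ is isomorphic to a bisubdivision of $J$. Let $A_1$ be the graph on $8$ vertices consisting of three internally disjoint paths of length three between two vertices; let $D_1$ and $D_2$ be the two graphs on $10$ vertices obtained from $K_4$ by replacing each of three edges by a path of length three, where the three edges are those at one vertex for $D_1$ and those of a triangle for $D_2$. Lemma 4.6. Let $G$ be a nonbipartite matching covered BN-graph that has none of $A_1$, $D_1$,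 $D_2$ as a conformal minor. Then $G$ has a Hamilton cycle (a cycle through all vertices of $G$). -/

import Mathlib

namespace BNGraph

universe u v

/-- A graph is matchable if it has a perfect matching. (The graph without vertices is matchable.) -/
def IsMatchable {V : Type u} (G : SimpleGraph V) : Prop :=
  ∃ M : G.Subgraph, M.IsPerfectMatching

/-- A connected graph is matching covered if each of its edges belongs to a perfect matching. -/
def IsMatchingCovered {V : Type u} (G : SimpleGraph V) : Prop :=
  G.Connected ∧ ∀ e ∈ G.edgeSet, ∃ M : G.Subgraph, M.IsPerfectMatching ∧ e ∈ M.edgeSet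

open Classical in
/-- The incidence vector in `ℝ^{E(G)}` of the edge set of a subgraph. -/
noncomputable def incidenceVector {V : Type u} {G : SimpleGraph V} (M : G.Subgraph) :
    G.edgeSet → ℝ :=
  fun e => if (e : Sym2 V) ∈ M.edgeSet then 1 else 0

/-- The perfect matching polytope `PM(G)`: all convex combinations of incidence vectors of
perfect matchings. -/
def perfectMatchingPolytope {V : Type u} (G : SimpleGraph V) : Set (G.edgeSet → ℝ) :=
  convexHull ℝ {x | ∃ M : G.Subgraph, M.IsPerfectMatching ∧ x = incidenceVector M}

open Classical in
/-- The set of vectors `x` in `ℝ^{E(G)}` with `x ≥ 0` and `x(∂(v)) = 1` for each vertex `v`. -/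
def fractionalMatchingPolytope {V : Type u} [Fintype V] (G : SimpleGraph V) :
    Set (G.edgeSet → ℝ) :=
  {x | (∀ e, 0 ≤ x e) ∧
    ∀ v : V, ∑ e : G.edgeSet, (if v ∈ (e : Sym2 V) then x e else 0) = 1}

/-- Birkhoff-von Neumann graphs: matchable graphs whose perfect matching polytope is described by
nonnegativity and the degree constraints alone. -/
def IsBN {V : Type u} [Fintype V] (G : SimpleGraph V) : Prop :=
  IsMatchable G ∧ perfectMatchingPolytope G = fractionalMatchingPolytope G

/-- The subgraph `H` of `G` is (as a graph) a bisubdivision of `J`, up to isomorphism: it consists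
of branch vertices `f u`, one for each vertex `u` of `J`, and of paths `p u v` of odd length (which
may be one), one for each edge `uv` of `J`, joining `f u` to `f v`, such that no branch vertex is
an inner vertex of a path and distinct paths share no inner vertices. The path of an edge, read
from its other end, is the reversed path. -/
def IsBisubdivision {U : Type v} {V : Type u} (J : SimpleGraph U) {G : SimpleGraph V}
    (H : G.Subgraph) : Prop :=
  ∃ (f : U → V) (p : ∀ u v : U, J.Adj u v → G.Walk (f u) (f v)),
    Function.Injective f ∧
    (∀ u v (h : J.Adj u v), (p u v h).IsPath ∧ Odd (p u v h).length) ∧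
    (∀ u v (h : J.Adj u v), p v u h.symm = (p u v h).reverse) ∧
    (∀ u v (h : J.Adj u v) (w : U), f w ∈ (p u v h).support → w = u ∨ w = v) ∧
    (∀ u v (h : J.Adj u v) u' v' (h' : J.Adj u' v'), s(u, v) ≠ s(u', v') →
      ∀ x ∈ (p u v h).support, x ∈ (p u' v' h').support → x ∈ Set.range f) ∧
    H.verts = Set.range f ∪ {x | ∃ u v, ∃ h : J.Adj u v, x ∈ (p u v h).support} ∧
    H.edgeSet = {e | ∃ u v, ∃ h : J.Adj u v, e ∈ (p u v h).edges}

/-- A subgraph `H` of `G` is conformal if `G - V(H)` is matchable. -/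
def IsConformal {V : Type u} {G : SimpleGraph V} (H : G.Subgraph) : Prop :=
  IsMatchable (G.induce H.vertsᶜ)

/-- `J` is a conformal minor of the matchable graph `G` if some bisubdivision of `J` is a
conformal subgraph of `G`. -/
def IsConformalMinor {U : Type v} {V : Type u} (J : SimpleGraph U) (G : SimpleGraph V) : Prop :=
  ∃ H : G.Subgraph, IsBisubdivision J H ∧ IsConformal H

/-- The graph `A₁`: three internally disjoint paths of length three between the vertices
`0` and `1`. -/
def graphA1 : SimpleGraph (Fin 8) :=
  SimpleGraph.fromEdgeSet
    {s(0, 2), s(2, 3), s(3, 1), s(0, 4), s(4, 5), s(5, 1), s(0, 6), s(6, 7), s(7, 1)}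

/-- The complete graph on `0, 1, 2, 3` in which each of the three edges at the vertex `0` is
replaced by a path of length three. -/
def graphD1 : SimpleGraph (Fin 10) :=
  SimpleGraph.fromEdgeSet
    {s(0, 4), s(4, 5), s(5, 1), s(0, 6), s(6, 7), s(7, 2), s(0, 8), s(8, 9), s(9, 3),
      s(1, 2), s(1, 3), s(2, 3)}

/-- The complete graph on `0, 1, 2, 3` in which each of the three edges of the triangle `1, 2, 3`
is replaced by a path of length three. -/
def graphD2 : SimpleGraph (Fin 10) :=
  SimpleGraph.fromEdgeSet
    {s(1, 4), s(4, 5), s(5, 2), s(2, 6), s(6, 7), s(7, 3), s(1, 8), s(8, 9), s(9, 3),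
      s(0, 1), s(0, 2), s(0, 3)}

end BNGraph

/-! Call an even cycle conformal if the rest of the graph has a perfect matching; a single edge
counts as an even cycle of length two. Any edge of a perfect matching is conformal, so some vertex
set `S` is maximal among those carrying a conformal even cycle. The claim is that `S` is everything;
then the cycle is Hamiltonian, and length two is impossible because a graph on two vertices is
bipartite.

Suppose `S` is not everything. By connectivity some edge `xy` leaves `S`. Let `n` be a perfect
matching containing `xy` and `m` a perfect matching of the complement of `S`. Following `n` and `m`
alternately from `x` gives an ear, an odd path that returns to `S` (`exists_isEar`). Removing the
inner vertices of ears leaves the outside matched by `m`.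

If the ends of the ear have odd distance along the cycle, cycle and ear form three odd paths with
common ends. Either one of the two arcs is an edge and can be dropped, giving an even cycle through
everything, or all three paths have inner vertices and `graphA1` is a conformal minor
(`evenCycleOn_of_theta`).

If the distance is even, colour the cycle alternately. The colour classes have equal size, so a
second, disjoint ear joins two vertices of the other colour (`exists_isEar_of_ncard_eq`). If the
ears do not cross, each closes up with an arc to an odd cycle, and the remaining vertices are
matchable. That contradicts the BN property: the point with value one half on the two odd cycles and
one on matching edges outside them is not a combination of perfect matchings
(`IsBN.not_odd_of_cycleCoverable`). If the ears cross, cycle and ears form a conformal bisubdivision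
of `K₄`. Excluding `graphD1` and `graphD2` forces two opposite edges of `K₄` to be unsubdivided, and
the other four paths form an even cycle through all its vertices (`K4Frame.evenCycleOn`).

In every surviving case the larger set carries a conformal even cycle, against maximality. The new
cycle need not contain the old one; only the vertex set grows. -/

namespace BNGraph

open Set

universe u

variable {V : Type u} {G : SimpleGraph V}

/-! ### Matchable vertex sets -/

/-- The subgraph induced by `S` has a perfect matching, given as a fixed point free involution
of `S`. -/
def MatchableOn (G : SimpleGraph V) (S : Set V) : Prop :=
  ∃ m : V → V, ∀ v ∈ S, m v ∈ S ∧ G.Adj v (m v) ∧ m (m v) = v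

theorem MatchableOn.empty : MatchableOn G ∅ := ⟨id, by simp⟩

theorem MatchableOn.pair {a b : V} (h : G.Adj a b) : MatchableOn G {a, b} := by
  classical
  refine ⟨Equiv.swap a b, ?_⟩
  rintro v (rfl | rfl)
  · simp [h]
  · simp [h.symm]

theorem MatchableOn.union {S T : Set V} (hS : MatchableOn G S) (hT : MatchableOn G T)
    (h : Disjoint S T) : MatchableOn G (S ∪ T) := by
  classical
  obtain ⟨m, hm⟩ := hS
  obtain ⟨n, hn⟩ := hT
  refine ⟨fun v => if v ∈ S then m v else n v, ?_⟩
  rintro v (hv | hv)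
  · simp [hv, hm v hv]
  · have h1 := Set.disjoint_right.1 h hv
    have h2 := Set.disjoint_right.1 h (hn v hv).1
    simp [h1, h2, hn v hv]

theorem MatchableOn.of_involution {S : Set V} {m : V → V} {T : Set V}
    (hm : ∀ v ∈ S, G.Adj v (m v) ∧ m (m v) = v) (hT : T ⊆ S) (hc : ∀ v ∈ T, m v ∈ T) :
    MatchableOn G T :=
  ⟨m, fun v hv => ⟨hc v hv, hm v (hT hv)⟩⟩

theorem MatchableOn.isMatchable {S : Set V} (h : MatchableOn G S) :
    IsMatchable (G.induce S) := by
  obtain ⟨m, hm⟩ := h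
  refine ⟨{ verts := Set.univ
            Adj := fun a b => m a = b
            adj_sub := ?_
            edge_vert := fun _ => Set.mem_univ _
            symm := ⟨?_⟩ }, ?_, fun _ => Set.mem_univ _⟩
  · rintro a b hab
    simpa [← hab] using (hm a a.2).2.1
  · rintro a b hab
    rw [← hab]; exact (hm a a.2).2.2
  · rintro a -
    refine ⟨⟨m a, (hm a a.2).1⟩, rfl, ?_⟩
    rintro b hb
    exact Subtype.ext (Eq.symm (show m a = b from hb))

theorem exists_involution_of_isPerfectMatching {M : G.Subgraph} (hM : M.IsPerfectMatching) :
    ∃ m : V → V, (∀ v w, M.Adj v w ↔ m v = w) ∧ ∀ v, G.Adj v (m v) ∧ m (m v) = v := by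
  rw [SimpleGraph.Subgraph.isPerfectMatching_iff] at hM
  choose m hm hm' using hM
  have key : ∀ v w, M.Adj v w ↔ m v = w :=
    fun v w => ⟨fun h => (hm' v w h).symm, fun h => h ▸ hm v⟩
  exact ⟨m, key, fun v => ⟨M.adj_sub (hm v), (key _ _).1 (hm v).symm⟩⟩

theorem IsMatchingCovered.exists_involution (h : IsMatchingCovered G) {a b : V}
    (hab : G.Adj a b) : ∃ m : V → V, m a = b ∧ ∀ v, G.Adj v (m v) ∧ m (m v) = v := by
  obtain ⟨M, hM, he⟩ := h.2 s(a, b) hab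
  obtain ⟨m, hm, hm'⟩ := exists_involution_of_isPerfectMatching hM
  exact ⟨m, (hm a b).1 he, hm'⟩

/-! ### Paths given by their vertex sequences -/

/-- There is a path of length `n` from `u` to `v` with set of inner vertices `I`. -/
def HasPath (G : SimpleGraph V) (u v : V) (n : ℕ) (I : Set V) : Prop :=
  ∃ c : ℕ → V, c 0 = u ∧ c n = v ∧ InjOn c (Iic n) ∧ (∀ i < n, G.Adj (c i) (c (i + 1))) ∧
    c '' Ioo 0 n = I

theorem HasPath.reverse {u v : V} {n : ℕ} {I : Set V} (h : HasPath G u v n I) :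
    HasPath G v u n I := by
  obtain ⟨c, h0, hn, hinj, hadj, hI⟩ := h
  refine ⟨fun i => c (n - i), by simpa, by simpa, ?_, ?_, ?_⟩
  · intro i hi j hj hij
    have := hinj (mem_Iic.2 (Nat.sub_le n i)) (mem_Iic.2 (Nat.sub_le n j)) hij
    simp only [mem_Iic] at hi hj
    omega
  · intro i hi
    have := hadj (n - (i + 1)) (by omega)
    rw [show n - (i + 1) + 1 = n - i by omega] at this
    exact this.symm
  · rw [← hI]
    ext x
    constructor
    · rintro ⟨i, hi, rfl⟩
      exact ⟨n - i, by simp only [mem_Ioo] at *; omega, rfl⟩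
    · rintro ⟨i, hi, rfl⟩
      simp only [mem_Ioo] at hi
      exact ⟨n - i, by simp only [mem_Ioo]; omega, by simp only; congr 1; omega⟩

theorem HasPath.single {u v : V} (h : G.Adj u v) : HasPath G u v 1 ∅ := by
  refine ⟨fun i => if i = 0 then u else v, by simp, by simp, ?_, ?_, ?_⟩
  · intro i hi j hj hij
    simp only [mem_Iic] at hi hj
    have := h.ne
    interval_cases i <;> interval_cases j <;> simp_all
  · intro i hi
    obtain rfl : i = 0 := by omega
    simpa
  · ext x
    simp only [mem_image, mem_Ioo, mem_empty_iff_false, iff_false]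
    rintro ⟨i, hi, -⟩
    omega

theorem HasPath.append {u v w : V} {n k : ℕ} {I J : Set V} (h : HasPath G u v n I)
    (h' : HasPath G v w k J) (hd : Disjoint I J) (huJ : u ∉ J) (hwI : w ∉ I) (huw : u ≠ w)
    (hn : n ≠ 0) (hk : k ≠ 0) :
    HasPath G u w (n + k) (I ∪ {v} ∪ J) := by
  obtain ⟨c, rfl, rfl, hinj, hadj, rfl⟩ := h
  obtain ⟨d, hd0, rfl, dinj, dadj, rfl⟩ := h'
  have key : ∀ i ≤ n, ∀ j, 0 < j → j ≤ k → c i ≠ d j := by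
    intro i hi j hj hjk he
    rcases Nat.eq_zero_or_pos i with rfl | hi0
    · rcases hjk.lt_or_eq with hjk | rfl
      · exact huJ ⟨j, ⟨hj, hjk⟩, he.symm⟩
      · exact huw he
    · rcases hi.lt_or_eq with hi | rfl
      · rcases hjk.lt_or_eq with hjk | rfl
        · exact Set.disjoint_left.1 hd ⟨i, ⟨hi0, hi⟩, rfl⟩ ⟨j, ⟨hj, hjk⟩, he.symm⟩
        · exact hwI ⟨i, ⟨hi0, hi⟩, he⟩
      · rw [← hd0] at he
        have := dinj (mem_Iic.2 (Nat.zero_le _)) (mem_Iic.2 hjk) he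
        omega
  refine ⟨fun i => if i ≤ n then c i else d (i - n), by simp, ?_, ?_, ?_, ?_⟩
  · simp [hk]
  · intro i hi j hj hij
    simp only [mem_Iic] at hi hj
    simp only at hij
    split_ifs at hij with h1 h2 h2
    · exact hinj h1 h2 hij
    · exact (key i h1 (j - n) (by omega) (by omega) hij).elim
    · exact (key j h2 (i - n) (by omega) (by omega) hij.symm).elim
    · have := dinj (mem_Iic.2 (by omega)) (mem_Iic.2 (by omega)) hij
      omega
  · intro i hi
    rcases lt_trichotomy i n with h1 | rfl | h1
    · simp only [h1.le, if_true, show i + 1 ≤ n by omega]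
      exact hadj i h1
    · simp only [le_refl, if_true, show ¬ i + 1 ≤ i by omega, if_false, ← hd0]
      simpa using dadj 0 (by omega)
    · simp only [show ¬ i ≤ n by omega, show ¬ i + 1 ≤ n by omega, if_false]
      have := dadj (i - n) (by omega)
      rwa [show i - n + 1 = i + 1 - n by omega] at this
  · ext x
    simp only [mem_image, mem_Ioo, mem_union, mem_singleton_iff]
    constructor
    · rintro ⟨i, hi, rfl⟩
      rcases lt_trichotomy i n with h1 | rfl | h1
      · exact Or.inl (Or.inl ⟨i, ⟨hi.1, h1⟩, by simp [h1.le]⟩)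
      · simp
      · exact Or.inr ⟨i - n, by omega, by simp [show ¬ i ≤ n by omega]⟩
    · rintro ((⟨i, hi, rfl⟩ | rfl) | ⟨i, hi, rfl⟩)
      · exact ⟨i, by omega, by simp [hi.2.le]⟩
      · exact ⟨n, by omega, by simp⟩
      · exact ⟨n + i, by omega, by simp [show i ≠ 0 by omega]⟩

theorem HasPath.left_notMem {u v : V} {n : ℕ} {I : Set V} (h : HasPath G u v n I) : u ∉ I := by
  obtain ⟨c, rfl, rfl, hinj, h, rfl⟩ := h
  rintro ⟨i, hi, he⟩
  have := hinj (mem_Iic.2 hi.2.le) (mem_Iic.2 (Nat.zero_le _)) he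
  exact hi.1.ne' this

theorem HasPath.right_notMem {u v : V} {n : ℕ} {I : Set V} (h : HasPath G u v n I) : v ∉ I :=
  h.reverse.left_notMem

/-- The first two inner vertices of a path of odd length at least three can be split off. -/
theorem HasPath.split {u v : V} {n : ℕ} {I : Set V} (h : HasPath G u v n I) (hn : Odd n)
    (hI : I.Nonempty) : ∃ y z n', Odd n' ∧ y ∈ I ∧ z ∈ I ∧ y ≠ z ∧ G.Adj u y ∧ G.Adj y z ∧
      HasPath G z v n' (I \ {y, z}) := by
  obtain ⟨c, rfl, rfl, hinj, h, rfl⟩ := h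
  obtain ⟨_, i, hi, rfl⟩ := hI
  simp only [mem_Ioo] at hi
  have hn3 : 3 ≤ n := by obtain ⟨k, rfl⟩ := hn; omega
  refine ⟨c 1, c 2, n - 2, ?_, ⟨1, by simp; omega, rfl⟩, ⟨2, by simp; omega, rfl⟩, ?_,
    by simpa using h 0 (by omega), h 1 (by omega), fun i => c (i + 2), rfl, ?_, ?_, ?_, ?_⟩
  · obtain ⟨k, rfl⟩ := hn
    exact ⟨k - 1, by omega⟩
  · intro he
    have := hinj (mem_Iic.2 (by omega)) (mem_Iic.2 (by omega)) he
    omega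
  · simp only; congr 1; omega
  · intro i hi j hj hij
    simp only [mem_Iic] at hi hj
    have := hinj (mem_Iic.2 (by omega)) (mem_Iic.2 (by omega)) hij
    omega
  · intro i hi
    exact h (i + 2) (by omega)
  · ext x
    simp only [mem_image, mem_Ioo, mem_sdiff, mem_insert_iff, mem_singleton_iff]
    constructor
    · rintro ⟨i, hi, rfl⟩
      refine ⟨⟨i + 2, by omega, rfl⟩, ?_⟩
      rintro (he | he)
      · have := hinj (mem_Iic.2 (by omega)) (mem_Iic.2 (by omega)) he
        omega
      · have := hinj (mem_Iic.2 (by omega)) (mem_Iic.2 (by omega)) he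
        omega
    · rintro ⟨⟨i, hi, rfl⟩, hx⟩
      push Not at hx
      have h1 : i ≠ 1 := by rintro rfl; exact hx.1 rfl
      have h2 : i ≠ 2 := by rintro rfl; exact hx.2 rfl
      exact ⟨i - 2, by omega, by congr 1; omega⟩

theorem exists_walk_of_sequence (c : ℕ → V) : ∀ n, (∀ i < n, G.Adj (c i) (c (i + 1))) →
    ∃ p : G.Walk (c 0) (c n), p.support = (List.range (n + 1)).map c ∧ p.length = n ∧
      p.edges = (List.range n).map fun i => s(c i, c (i + 1))
  | 0, _ => ⟨SimpleGraph.Walk.nil, by simp⟩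
  | n + 1, h => by
    obtain ⟨p, hp, hl, he⟩ := exists_walk_of_sequence c n fun i hi => h i (by omega)
    refine ⟨p.concat (h n (by omega)), ?_, by simp [hl], ?_⟩
    · rw [SimpleGraph.Walk.support_concat, hp, List.range_succ (n := n + 1)]
      simp
    · rw [SimpleGraph.Walk.edges_concat, he, List.range_succ (n := n)]
      simp

theorem HasPath.exists_walk {u v : V} {n : ℕ} {I : Set V} (h : HasPath G u v n I) :
    ∃ p : G.Walk u v, p.IsPath ∧ p.length = n ∧ ∀ x, x ∈ p.support ↔ x = u ∨ x = v ∨ x ∈ I := by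
  obtain ⟨c, rfl, rfl, hinj, h, rfl⟩ := h
  obtain ⟨p, hp, hl, -⟩ := exists_walk_of_sequence c n h
  refine ⟨p, ?_, hl, ?_⟩
  · rw [SimpleGraph.Walk.isPath_def, hp]
    refine List.Nodup.map_on ?_ List.nodup_range
    intro i hi j hj hij
    simp only [List.mem_range] at hi hj
    exact hinj (mem_Iic.2 (by omega)) (mem_Iic.2 (by omega)) hij
  · intro x
    rw [hp]
    simp only [List.mem_map, List.mem_range, mem_image, mem_Ioo]
    constructor
    · rintro ⟨i, hi, rfl⟩
      by_cases h0 : i = 0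
      · simp [h0]
      by_cases h1 : i = n
      · simp [h1]
      exact Or.inr (Or.inr ⟨i, by omega, rfl⟩)
    · rintro (rfl | rfl | ⟨i, hi, rfl⟩)
      · exact ⟨0, by omega, rfl⟩
      · exact ⟨n, by omega, rfl⟩
      · exact ⟨i, by omega, rfl⟩

theorem matchableOn_image_Ico {c : ℕ → V} {a k : ℕ} (hinj : InjOn c (Ico a (a + 2 * k)))
    (hadj : ∀ i, a ≤ i → i + 1 < a + 2 * k → G.Adj (c i) (c (i + 1))) :
    MatchableOn G (c '' Ico a (a + 2 * k)) := by
  induction k with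
  | zero => simpa using MatchableOn.empty
  | succ k ih =>
    have h1 := ih (hinj.mono (Ico_subset_Ico_right (by omega)))
      fun i hi hi' => hadj i hi (by omega)
    have h2 := MatchableOn.pair (hadj (a + 2 * k) (by omega) (by omega))
    have h3 : c '' Ico a (a + 2 * (k + 1)) =
        c '' Ico a (a + 2 * k) ∪ {c (a + 2 * k), c (a + 2 * k + 1)} := by
      rw [← image_pair, ← image_union]
      congr 1
      ext i
      simp only [mem_Ico, mem_union, mem_insert_iff, mem_singleton_iff]
      omega
    rw [h3]
    refine h1.union h2 ?_
    rw [← image_pair]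
    rw [Set.disjoint_left]
    rintro _ ⟨i, hi, rfl⟩ ⟨j, hj, hij⟩
    simp only [mem_insert_iff, mem_singleton_iff, mem_Ico] at hi hj
    have := hinj (mem_Ico.2 (by omega)) (mem_Ico.2 (by omega)) hij
    omega

theorem HasPath.matchableOn {u v : V} {n : ℕ} {I : Set V} (h : HasPath G u v n I) (hn : Odd n) :
    MatchableOn G I := by
  obtain ⟨c, rfl, rfl, hinj, h, rfl⟩ := h
  obtain ⟨k, rfl⟩ := hn
  have : Ioo 0 (2 * k + 1) = Ico 1 (1 + 2 * k) := by
    ext i; simp only [mem_Ioo, mem_Ico]; omega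
  rw [this]
  refine matchableOn_image_Ico (hinj.mono fun i hi => ?_) fun i _ hi => h i (by omega)
  simp only [mem_Ico, mem_Iic] at *
  omega

/-! ### Cycles given by their vertex sequences -/

/-- The sequence `c 0, ..., c (n - 1)` is the vertex sequence of a cycle. The cases `n = 1` and
`n = 2` are allowed; the latter is an edge. -/
structure IsCyc (G : SimpleGraph V) (c : ℕ → V) (n : ℕ) : Prop where
  closed : c n = c 0
  inj : InjOn c (Iio n)
  adj : ∀ i < n, G.Adj (c i) (c (i + 1))

theorem IsCyc.rotate {c : ℕ → V} {n : ℕ} (h : IsCyc G c n) {k : ℕ} (hk : k < n) :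
    IsCyc G (fun i => c ((i + k) % n)) n where
  closed := by simp
  inj := by
    intro i hi j hj hij
    have := h.inj (mem_Iio.2 (Nat.mod_lt _ (by omega))) (mem_Iio.2 (Nat.mod_lt _ (by omega))) hij
    exact Nat.ModEq.eq_of_lt_of_lt (Nat.ModEq.add_right_cancel' k this) hi hj
  adj := by
    intro i hi
    have h1 : (i + k) % n < n := Nat.mod_lt _ (by omega)
    have h2 := h.adj _ h1
    rcases Nat.lt_or_ge ((i + k) % n + 1) n with h3 | h3
    · have : (i + 1 + k) % n = (i + k) % n + 1 := by
        rw [show i + 1 + k = i + k + 1 by omega, Nat.add_mod_eq_ite]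
        rw [Nat.mod_eq_of_lt (show 1 < n by omega)]
        simp; omega
      simpa only [this] using h2
    · have h4 : (i + k) % n + 1 = n := by omega
      have : (i + 1 + k) % n = 0 := by
        rw [show i + 1 + k = i + k + 1 by omega, ← Nat.mod_add_mod, h4, Nat.mod_self]
      rw [h4, h.closed] at h2
      simpa only [this] using h2

theorem IsCyc.image_rotate {c : ℕ → V} {n : ℕ} {k : ℕ} (hk : k < n) :
    (fun i => c ((i + k) % n)) '' Iio n = c '' Iio n := by
  ext x
  constructor
  · rintro ⟨i, hi, rfl⟩
    exact ⟨_, Nat.mod_lt _ (by omega), rfl⟩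
  · rintro ⟨i, hi, rfl⟩
    refine ⟨(i + (n - k)) % n, Nat.mod_lt _ (by omega), ?_⟩
    simp only [Nat.mod_add_mod]
    rw [show i + (n - k) + k = i + n by omega, Nat.add_mod_right, Nat.mod_eq_of_lt hi]

/-- An arc of a cycle that does not wrap around. -/
theorem IsCyc.hasPath {c : ℕ → V} {n : ℕ} (h : IsCyc G c n) {i j : ℕ} (hij : i < j) (hj : j ≤ n)
    (h' : 0 < i ∨ j < n) : HasPath G (c i) (c j) (j - i) (c '' Ioo i j) := by
  have hinj : ∀ a b, i ≤ a → a ≤ j → i ≤ b → b ≤ j → c a = c b → a = b := by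
    intro a b ha ha' hb hb' hab
    by_cases h1 : a = n
    · by_cases h2 : b = n
      · omega
      · subst h1
        rw [h.closed] at hab
        have := h.inj (mem_Iio.2 (by omega)) (mem_Iio.2 (by omega)) hab
        omega
    · by_cases h2 : b = n
      · subst h2
        rw [h.closed] at hab
        have := h.inj (mem_Iio.2 (by omega)) (mem_Iio.2 (by omega)) hab
        omega
      · exact h.inj (mem_Iio.2 (by omega)) (mem_Iio.2 (by omega)) hab
  refine ⟨fun k => c (i + k), by simp, by simp only; congr 1; omega, ?_, ?_, ?_⟩
  · intro a ha b hb hab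
    simp only [mem_Iic] at ha hb
    have := hinj _ _ (by omega) (by omega) (by omega) (by omega) hab
    omega
  · intro k hk
    exact h.adj (i + k) (by omega)
  · ext x
    simp only [mem_image, mem_Ioo]
    constructor
    · rintro ⟨k, hk, rfl⟩
      exact ⟨i + k, by omega, rfl⟩
    · rintro ⟨k, hk, rfl⟩
      exact ⟨k - i, by omega, by congr 1; omega⟩

/-- Two internally disjoint paths with the same ends form a cycle. -/
theorem HasPath.exists_isCyc {u v : V} {n k : ℕ} {I J : Set V} (h : HasPath G u v n I)
    (h' : HasPath G v u k J) (hd : Disjoint I J) (hn : n ≠ 0) (hk : k ≠ 0) :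
    ∃ c, IsCyc G c (n + k) ∧ c '' Iio (n + k) = {u, v} ∪ I ∪ J := by
  have hu := h'.right_notMem
  have hv := h'.left_notMem
  obtain ⟨c, rfl, rfl, hinj, hadj, rfl⟩ := h
  obtain ⟨d, hd0, hdk, dinj, dadj, rfl⟩ := h'
  have key : ∀ i ≤ n, ∀ j, 0 < j → j < k → c i ≠ d j := by
    intro i hi j hj hjk he
    rcases Nat.eq_zero_or_pos i with rfl | hi0
    · exact hu ⟨j, ⟨hj, hjk⟩, he.symm⟩
    · rcases hi.lt_or_eq with hi | rfl
      · exact Set.disjoint_left.1 hd ⟨i, ⟨hi0, hi⟩, rfl⟩ ⟨j, ⟨hj, hjk⟩, he.symm⟩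
      · exact hv ⟨j, ⟨hj, hjk⟩, he.symm⟩
  refine ⟨fun i => if i ≤ n then c i else d (i - n), ⟨?_, ?_, ?_⟩, ?_⟩
  · simp [hk, hdk]
  · intro i hi j hj hij
    simp only [mem_Iio] at hi hj
    simp only at hij
    split_ifs at hij with h1 h2 h2
    · exact hinj h1 h2 hij
    · exact (key i h1 (j - n) (by omega) (by omega) hij).elim
    · exact (key j h2 (i - n) (by omega) (by omega) hij.symm).elim
    · have := dinj (mem_Iic.2 (by omega)) (mem_Iic.2 (by omega)) hij
      omega
  · intro i hi
    rcases lt_trichotomy i n with h1 | rfl | h1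
    · simp only [h1.le, if_true, show i + 1 ≤ n by omega]
      exact hadj i h1
    · simp only [le_refl, if_true, show ¬ i + 1 ≤ i by omega, if_false, ← hd0]
      simpa using dadj 0 (by omega)
    · simp only [show ¬ i ≤ n by omega, show ¬ i + 1 ≤ n by omega, if_false]
      have := dadj (i - n) (by omega)
      rwa [show i - n + 1 = i + 1 - n by omega] at this
  · ext x
    simp only [mem_image, mem_Ioo, mem_union, mem_singleton_iff, mem_insert_iff, mem_Iio]
    constructor
    · rintro ⟨i, hi, rfl⟩
      rcases lt_trichotomy i n with h1 | rfl | h1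
      · rcases Nat.eq_zero_or_pos i with rfl | h0
        · simp
        · exact Or.inl (Or.inr ⟨i, ⟨h0, h1⟩, by simp [h1.le]⟩)
      · simp
      · exact Or.inr ⟨i - n, by omega, by simp [show ¬ i ≤ n by omega]⟩
    · rintro (((rfl | rfl) | ⟨i, hi, rfl⟩) | ⟨i, hi, rfl⟩)
      · exact ⟨0, by omega, by simp⟩
      · exact ⟨n, by omega, by simp⟩
      · exact ⟨i, by omega, by simp [hi.2.le]⟩
      · exact ⟨n + i, by omega, by simp [show i ≠ 0 by omega]⟩

theorem IsCyc.exists_isHamiltonianCycle [DecidableEq V] {c : ℕ → V} {n : ℕ} (h : IsCyc G c n)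
    (hn : 3 ≤ n) (hc : c '' Iio n = univ) :
    ∃ (a : V) (C : G.Walk a a), C.IsHamiltonianCycle := by
  obtain ⟨k, rfl⟩ : ∃ k, n = k + 1 := ⟨n - 1, by omega⟩
  obtain ⟨p, hp, hl, he⟩ := exists_walk_of_sequence c k fun i hi => h.adj i (by omega)
  have hadj : G.Adj (c k) (c 0) := by simpa [h.closed] using h.adj k (by omega)
  have hpath : p.IsPath := by
    rw [SimpleGraph.Walk.isPath_def, hp]
    refine List.Nodup.map_on ?_ List.nodup_range
    intro i hi j hj hij
    simp only [List.mem_range] at hi hj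
    exact h.inj (mem_Iio.2 (by omega)) (mem_Iio.2 (by omega)) hij
  refine ⟨c k, SimpleGraph.Walk.cons hadj p, ?_, ?_⟩
  · rw [SimpleGraph.Walk.cons_isCycle_iff]
    refine ⟨hpath, ?_⟩
    rw [he]
    simp only [List.mem_map, List.mem_range, not_exists, not_and]
    intro i hi hs
    rw [Sym2.eq_iff] at hs
    -- The closing edge could only repeat an edge of the path if `k = 1`; this is where `3 ≤ n` is
    -- needed.
    rcases hs with ⟨h1, h2⟩ | ⟨h1, h2⟩
    · have := h.inj (mem_Iio.2 (by omega)) (mem_Iio.2 (by omega)) h1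
      omega
    · have := h.inj (mem_Iio.2 (by omega)) (mem_Iio.2 (by omega)) h1
      have := h.inj (mem_Iio.2 (by omega)) (mem_Iio.2 (by omega)) h2
      omega
  · rw [SimpleGraph.Walk.tail_cons]
    have : p.IsHamiltonian := by
      refine hpath.isHamiltonian_of_mem fun w => ?_
      have : w ∈ c '' Iio (k + 1) := hc ▸ mem_univ w
      obtain ⟨i, hi, rfl⟩ := this
      rw [hp]
      exact List.mem_map.2 ⟨i, List.mem_range.2 hi, rfl⟩
    simpa [SimpleGraph.Walk.IsHamiltonian] using this

/-! ### Ears of an alternating pair of matchings -/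

/-- An ear of the vertex set `S`: a path of odd length from `x ∈ S` to `w ∈ S` with inner vertices
outside `S`, whose edges are alternately of the form `v, n v` and `v, m v`. -/
structure IsEar (G : SimpleGraph V) (S : Set V) (m n : V → V) (x w : V) (I : Set V) : Prop where
  right_mem : w ∈ S
  path : ∃ l, Odd l ∧ HasPath G x w l I
  ne : w ≠ x
  disjoint : Disjoint I S
  inner_closed : ∀ v ∈ I, m v ∈ I
  closed : ∀ v ∈ insert x (insert w I), n v ∈ insert x (insert w I)
  disjoint_of_closed : ∀ T : Set V, (∀ v ∈ T, n v ∈ T) → (∀ v ∈ T, v ∉ S → m v ∈ T) → x ∉ T →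
    ∀ v ∈ T, v ∉ insert x (insert w I)

/-- Walk from `x` along `n` to `y`. If `y` lies outside `S`, go on along `m` to `z`, absorb `y` and
`z` into `S`, and continue from `z`. The complement of `S` shrinks, so the induction is on its size,
and the absorbed vertices cannot be met again. -/
theorem exists_isEar [Finite V] {m n : V → V} (hn : ∀ v, G.Adj v (n v) ∧ n (n v) = v) (S : Set V)
    (hm : ∀ v ∈ Sᶜ, m v ∈ Sᶜ ∧ G.Adj v (m v) ∧ m (m v) = v) {x : V} (hx : x ∈ S) :
    ∃ w I, IsEar G S m n x w I := by
  induction hk : Sᶜ.ncard using Nat.strong_induction_on generalizing S x with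
  | _ k ih =>
  have hxn : n x ≠ x := (hn x).1.ne'
  by_cases hy : n x ∈ S
  · refine ⟨n x, ∅, hy, ⟨1, odd_one, HasPath.single (hn x).1⟩, hxn, by simp, by simp, ?_, ?_⟩
    · simp [(hn x).2]
    · intro T hT _ hxT v hv
      simp only [mem_insert_iff, mem_empty_iff_false, or_false, not_or]
      refine ⟨fun h => hxT (h ▸ hv), fun h => hxT ?_⟩
      have := hT v hv
      rwa [h, (hn x).2] at this
  obtain ⟨hzS, hyz, hmz⟩ := hm _ hy
  generalize hydef : n x = y at *
  generalize hzdef : m y = z at *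
  have hny : n y = x := by rw [← hydef, (hn x).2]
  have hzS' : z ∉ S := hzS
  have hxz : x ≠ z := fun h => hzS' (h ▸ hx)
  set S' : Set V := insert y (insert z S) with hS'
  have hSc : S'ᶜ ⊂ Sᶜ := by
    refine ⟨compl_subset_compl.2 fun a ha => by simp [hS', ha], fun h => ?_⟩
    exact h hy (by simp [hS'])
  have hm' : ∀ v ∈ S'ᶜ, m v ∈ S'ᶜ ∧ G.Adj v (m v) ∧ m (m v) = v := by
    intro v hv
    obtain ⟨h1, h2, h3⟩ := hm v (hSc.1 hv)
    refine ⟨?_, h2, h3⟩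
    simp only [hS', mem_compl_iff, mem_insert_iff, not_or] at hv ⊢
    refine ⟨fun h => ?_, fun h => ?_, h1⟩
    · rw [h, hzdef] at h3
      exact hv.2.1 h3.symm
    · rw [h, hmz] at h3
      exact hv.1 h3.symm
  obtain ⟨w, I, h⟩ := ih _ (hk ▸ Set.ncard_lt_ncard hSc) S' hm' (x := z) (by simp [hS']) rfl
  obtain ⟨l, hl, hp⟩ := h.path
  have hIS' : ∀ a ∈ I, a ∉ S' := fun a ha => Set.disjoint_left.1 h.disjoint ha
  have hIS : ∀ a ∈ I, a ∉ S := fun a ha h' => hIS' a ha (by simp [hS', h'])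
  have hIy : y ∉ I := fun ha => hIS' y ha (by simp [hS'])
  have hIz : z ∉ I := fun ha => hIS' z ha (by simp [hS'])
  have hxI : x ∉ I := fun ha => hIS x ha hx
  have hxy : x ≠ y := hxn.symm
  -- The shorter ear is closed under `n`, which pairs `x` with `y`. So it cannot end at `y`, as it
  -- would have to contain `x`, nor at `x`, as it would have to contain `y`.
  have hwy : w ≠ y := by
    rintro rfl
    have := h.closed w (by simp)
    simp [hny, hxz, hxy, hxI] at this
  have hwx : w ≠ x := by
    rintro rfl
    have := h.closed w (by simp)
    simp [hydef, hyz.ne, hwy.symm, hIy] at this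
  have hwS : w ∈ S := by
    have := h.right_mem
    simpa [hS', hwy, h.ne] using this
  have hxyp : HasPath G x y 1 ∅ := HasPath.single (hydef ▸ (hn x).1 : G.Adj x y)
  have hxz' : HasPath G x z 2 {y} := by
    simpa using hxyp.append (HasPath.single hyz) (by simp) (by simp) (by simp) hxz (by simp)
      (by simp)
  have hl0 : l ≠ 0 := by rintro rfl; simp at hl
  have hpath := hxz'.append hp (by simpa using hIy) hxI (by simpa using hwy) hwx.symm (by simp) hl0
  refine ⟨w, {y} ∪ {z} ∪ I, hwS, ⟨_, ?_, hpath⟩, hwx, ?_, ?_, ?_, ?_⟩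
  · exact even_two.add_odd hl
  · rw [Set.disjoint_left]
    rintro a ((rfl | rfl) | ha)
    · exact hy
    · exact hzS'
    · exact hIS a ha
  · rintro a ((rfl | rfl) | ha)
    · simp [hzdef]
    · simp [hmz]
    · exact Or.inr (h.inner_closed a ha)
  · have aux : ∀ v ∈ insert z (insert w I), n v ∈ insert x (insert w ({y} ∪ {z} ∪ I)) := by
      intro v hv
      have := h.closed v hv
      simp only [mem_insert_iff, mem_union, mem_singleton_iff] at this ⊢
      tauto
    intro v hv
    simp only [mem_insert_iff, mem_union, mem_singleton_iff] at hv
    rcases hv with rfl | rfl | (rfl | rfl) | hv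
    · simp [hydef]
    · exact aux _ (by simp)
    · simp [hny]
    · exact aux _ (by simp)
    · exact aux _ (by simp [hv])
  -- A set with these closure properties that meets the ear can be traced back along it to `x`. Here
  -- this gives that `T` avoids `y`, then `z`, and then the rest by induction.
  · intro T hT hT' hxT
    have hyT : y ∉ T := fun hyT => hxT (hny ▸ hT y hyT)
    have hzT : z ∉ T := fun hzT => hyT (hmz ▸ hT' z hzT hzS')
    intro v hv hv'
    have := h.disjoint_of_closed T hT (fun a ha ha' => hT' a ha fun h' => ha' (by simp [hS', h']))
      hzT v hv
    simp only [mem_insert_iff, mem_union, mem_singleton_iff, not_or] at hv' this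
    rcases hv' with rfl | rfl | (rfl | rfl) | hv'
    · exact hxT hv
    · exact this.2.1 rfl
    · exact hyT hv
    · exact hzT hv
    · exact this.2.2 hv'

/-- Two ears that do not share the first vertex of one of them are disjoint. -/
theorem IsEar.disjoint_of_notMem {S : Set V} {m n : V → V} {x w x' w' : V} {I I' : Set V}
    (h : IsEar G S m n x w I) (h' : IsEar G S m n x' w' I')
    (hx : x ∈ S) (hx' : x' ∈ S) (hne : x ∉ insert x' (insert w' I')) :
    Disjoint (insert x (insert w I)) (insert x' (insert w' I')) := by
  rw [Set.disjoint_left]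
  intro a ha ha'
  have key : ∀ {x w I v}, x ∈ S → IsEar G S m n x w I → v ∈ insert x (insert w I) → v ∉ S →
      v ∈ I := by
    intro x w I v hx h hv hvS
    rcases hv with rfl | rfl | hv
    · exact (hvS hx).elim
    · exact (hvS h.right_mem).elim
    · exact hv
  -- The intersection of the two ears inherits both closure properties and misses `x`, so it is
  -- empty.
  refine h.disjoint_of_closed (insert x (insert w I) ∩ insert x' (insert w' I'))
    (fun v hv => ⟨h.closed v hv.1, h'.closed v hv.2⟩) (fun v hv hvS => ⟨?_, ?_⟩)
    (fun hx => hne hx.2) a ⟨ha, ha'⟩ ha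
  · exact Or.inr (Or.inr (h.inner_closed v (key hx h hv.1 hvS)))
  · exact Or.inr (Or.inr (h'.inner_closed v (key hx' h' hv.2 hvS)))

theorem IsEar.nonempty {S : Set V} {m n : V → V} {x w : V} {I : Set V}
    (h : IsEar G S m n x w I) (hx : n x ∉ S) (hxS : x ∈ S) : I.Nonempty := by
  have := h.closed x (by simp)
  rcases this with h1 | h1 | h1
  · exact (hx (h1.symm ▸ hxS)).elim
  · exact (hx (h1 ▸ h.right_mem)).elim
  · exact ⟨_, h1⟩

/-- If `S` is the disjoint union of two sets of equal size and some ear has both ends in the first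
one, then a disjoint ear has both ends in the second one. -/
theorem exists_isEar_of_ncard_eq [Finite V] {m n : V → V}
    (hn : ∀ v, G.Adj v (n v) ∧ n (n v) = v) {S B W : Set V}
    (hm : ∀ v ∈ Sᶜ, m v ∈ Sᶜ ∧ G.Adj v (m v) ∧ m (m v) = v) (hS : B ∪ W = S) (hBW : Disjoint B W)
    (hcard : B.ncard = W.ncard) {x w : V} {I : Set V} (hx : x ∈ B) (hw : w ∈ B)
    (h : IsEar G S m n x w I) :
    ∃ x' w' I', x' ∈ W ∧ w' ∈ W ∧ IsEar G S m n x' w' I' ∧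
      Disjoint (insert x (insert w I)) (insert x' (insert w' I')) := by
  have hBS : B ⊆ S := hS ▸ subset_union_left
  have hWS : W ⊆ S := hS ▸ subset_union_right
  choose! r J hr using fun a (ha : a ∈ S) => exists_isEar hn S hm ha
  have hmem : ∀ {a x w I}, a ∈ S → IsEar G S m n x w I → a ∈ insert x (insert w I) →
      a = x ∨ a = w := by
    rintro a x w I ha h (h1 | h1 | h1)
    · exact Or.inl h1
    · exact Or.inr h1
    · exact (Set.disjoint_left.1 h.disjoint h1 ha).elim
  have hdis : ∀ a ∈ B, a ∉ W := fun a ha => Set.disjoint_left.1 hBW ha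
  by_cases hex : ∃ x' ∈ W, r x' ∈ W
  · obtain ⟨x', hx', hw'⟩ := hex
    refine ⟨x', r x', J x', hx', hw', hr x' (hWS hx'),
      h.disjoint_of_notMem (hr x' (hWS hx')) (hBS hx) (hWS hx') fun hmx => ?_⟩
    rcases hmem (hBS hx) (hr x' (hWS hx')) hmx with h1 | h1
    · exact hdis x hx (h1 ▸ hx')
    · exact hdis x hx (h1 ▸ hw')
  -- If every ear from `W` ended in `B`, the end map `r` would be injective, hence onto `B` by the
  -- equal sizes. Some ear from `W` would then end at `x`, although it must be disjoint from the
  -- given ear.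
  · exfalso
    push Not at hex
    have hmaps : ∀ a ∈ W, r a ∈ B := fun a ha => by
      have := (hr a (hWS ha)).right_mem
      rw [← hS] at this
      exact this.resolve_right (hex a ha)
    have hinj : InjOn r W := by
      intro a ha b hb hab
      by_contra hne
      have hna : a ∉ insert b (insert (r b) (J b)) := fun hma => by
        rcases hmem (hWS ha) (hr b (hWS hb)) hma with h1 | h1
        · exact hne h1
        · exact hex b hb (h1 ▸ ha)
      have := (hr a (hWS ha)).disjoint_of_notMem (hr b (hWS hb)) (hWS ha) (hWS hb) hna
      refine Set.disjoint_left.1 this (show r a ∈ _ by simp) (by simp [hab])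
    have himg : r '' W = B := by
      refine Set.eq_of_subset_of_ncard_le (image_subset_iff.2 hmaps) ?_ (Set.toFinite _)
      rw [hinj.ncard_image, hcard]
    obtain ⟨a, ha, hax⟩ : x ∈ r '' W := himg ▸ hx
    have hna : a ∉ insert x (insert w I) := fun hma => by
      rcases hmem (hWS ha) h hma with h1 | h1
      · exact hdis x hx (h1 ▸ ha)
      · exact hdis w hw (h1 ▸ ha)
    have := (hr a (hWS ha)).disjoint_of_notMem h (hWS ha) (hBS hx) hna
    exact Set.disjoint_left.1 this (show x ∈ _ by simp [hax]) (by simp)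

/-! ### Permutations along edges and Birkhoff-von Neumann graphs -/

/-- The vertex set `A` is partitioned by directed cycles of the graph (an edge counts as a directed
cycle of length two). -/
def CycleCoverable (G : SimpleGraph V) (A : Set V) : Prop :=
  ∃ s : V → V, MapsTo s A A ∧ InjOn s A ∧ ∀ v ∈ A, G.Adj v (s v)

theorem MatchableOn.cycleCoverable {A : Set V} (h : MatchableOn G A) : CycleCoverable G A := by
  obtain ⟨m, hm⟩ := h
  refine ⟨m, fun v hv => (hm v hv).1, fun v hv w hw hvw => ?_, fun v hv => (hm v hv).2.1⟩
  rw [← (hm v hv).2.2, hvw, (hm w hw).2.2]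

/-- The glued map is also recorded to preserve each part, since the parity argument needs the odd
cycle as an invariant set. -/
theorem CycleCoverable.exists_union {A B : Set V} (hA : CycleCoverable G A) (hB : CycleCoverable G B)
    (h : Disjoint A B) : ∃ s : V → V, MapsTo s A A ∧ MapsTo s B B ∧ InjOn s (A ∪ B) ∧
      ∀ v ∈ A ∪ B, G.Adj v (s v) := by
  classical
  obtain ⟨s, hs, hsi, hsa⟩ := hA
  obtain ⟨t, ht, hti, hta⟩ := hB
  have hAs : ∀ v ∈ A, (if v ∈ A then s v else t v) = s v := fun v hv => by simp [hv]
  have hBt : ∀ v ∈ B, (if v ∈ A then s v else t v) = t v :=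
    fun v hv => by simp [Set.disjoint_right.1 h hv]
  refine ⟨fun v => if v ∈ A then s v else t v, fun v hv => ?_, fun v hv => ?_, ?_, ?_⟩
  · simpa only [hAs v hv] using hs hv
  · simpa only [hBt v hv] using ht hv
  · rintro v (hv | hv) w (hw | hw) hvw
    · simp only [hAs v hv, hAs w hw] at hvw
      exact hsi hv hw hvw
    · simp only [hAs v hv, hBt w hw] at hvw
      exact (Set.disjoint_left.1 h (hs hv) (hvw ▸ ht hw)).elim
    · simp only [hBt v hv, hAs w hw] at hvw
      exact (Set.disjoint_left.1 h (hs hw) (hvw ▸ ht hv)).elim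
    · simp only [hBt v hv, hBt w hw] at hvw
      exact hti hv hw hvw
  · rintro v (hv | hv)
    · simpa only [hAs v hv] using hsa v hv
    · simpa only [hBt v hv] using hta v hv

theorem CycleCoverable.union {A B : Set V} (hA : CycleCoverable G A) (hB : CycleCoverable G B)
    (h : Disjoint A B) : CycleCoverable G (A ∪ B) := by
  obtain ⟨s, h1, h2, h3, h4⟩ := hA.exists_union hB h
  exact ⟨s, h1.union_union h2, h3, h4⟩

theorem IsCyc.cycleCoverable {c : ℕ → V} {n : ℕ} (h : IsCyc G c n) :
    CycleCoverable G (c '' Iio n) := by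
  have hinv : ∀ i < n, Function.invFunOn c (Iio n) (c i) = i := fun i hi => by
    have h1 : ∃ j ∈ Iio n, c j = c i := ⟨i, hi, rfl⟩
    exact h.inj (Function.invFunOn_mem h1) hi (Function.invFunOn_eq h1)
  refine ⟨fun v => c (Function.invFunOn c (Iio n) v + 1), ?_, ?_, ?_⟩
  · rintro _ ⟨i, hi, rfl⟩
    simp only [hinv i hi]
    rcases (show i + 1 ≤ n from hi).lt_or_eq with h1 | h1
    · exact ⟨i + 1, h1, rfl⟩
    · rw [h1, h.closed]
      exact ⟨0, mem_Iio.2 (by omega), rfl⟩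
  · rintro _ ⟨i, hi, rfl⟩ _ ⟨j, hj, rfl⟩ hij
    simp only [hinv i hi, hinv j hj] at hij
    simp only [mem_Iio] at hi hj
    have aux : ∀ {i j}, i < n → j < n → i + 1 = n → c (i + 1) = c (j + 1) → i = j := by
      intro i j hi hj h1 hij
      by_contra hne
      rw [h1, h.closed] at hij
      have := h.inj (mem_Iio.2 (by omega)) (mem_Iio.2 (by omega)) hij
      omega
    by_cases h1 : i + 1 = n
    · rw [aux hi hj h1 hij]
    by_cases h2 : j + 1 = n
    · rw [aux hj hi h2 hij.symm]
    have := h.inj (mem_Iio.2 (by omega)) (mem_Iio.2 (by omega)) hij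
    rw [show i = j by omega]
  · rintro _ ⟨i, hi, rfl⟩
    simp only [hinv i hi]
    exact h.adj i hi

open Classical in
/-- Half the number of times a permutation along edges traverses each edge is a point of the
fractional matching polytope. -/
theorem mem_fractionalMatchingPolytope [Fintype V] {s : V → V} (hs : Function.Injective s)
    (hadj : ∀ v, G.Adj v (s v)) :
    (fun e : G.edgeSet => ∑ v, if s(v, s v) = (e : Sym2 V) then (1 / 2 : ℝ) else 0) ∈
      fractionalMatchingPolytope G := by
  refine ⟨fun e => Finset.sum_nonneg fun v _ => by split_ifs <;> norm_num, fun w => ?_⟩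
  have hbij : Function.Bijective s := Finite.injective_iff_bijective.1 hs
  obtain ⟨w', hw'⟩ := hbij.2 w
  calc ∑ e : G.edgeSet, (if w ∈ (e : Sym2 V) then
          ∑ v, if s(v, s v) = (e : Sym2 V) then (1 / 2 : ℝ) else 0 else 0)
      = ∑ e : G.edgeSet, ∑ v,
          if s(v, s v) = (e : Sym2 V) then (if w ∈ (e : Sym2 V) then (1 / 2 : ℝ) else 0) else 0 := by
        refine Finset.sum_congr rfl fun e _ => ?_
        split_ifs with h <;> simp
    _ = ∑ v, ∑ e : G.edgeSet,
          if s(v, s v) = (e : Sym2 V) then (if w ∈ (e : Sym2 V) then (1 / 2 : ℝ) else 0) else 0 :=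
        Finset.sum_comm
    _ = ∑ v, if w ∈ s(v, s v) then (1 / 2 : ℝ) else 0 := by
        refine Finset.sum_congr rfl fun v _ => ?_
        rw [Finset.sum_eq_single (⟨s(v, s v), hadj v⟩ : G.edgeSet)]
        · simp
        · intro e _ he
          rw [if_neg]
          exact fun h => he (Subtype.ext h.symm)
        · simp
    -- The vertex `w` is traversed twice, on leaving it and on entering it from its preimage `w'`;
    -- `w ≠ w'` because there are no loops.
    _ = ∑ v, ((if v = w then (1 / 2 : ℝ) else 0) + if v = w' then (1 / 2 : ℝ) else 0) := by
        refine Finset.sum_congr rfl fun v _ => ?_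
        have h1 : w = s v ↔ v = w' := by
          rw [← hw', hs.eq_iff, eq_comm]
        simp only [Sym2.mem_iff, h1]
        by_cases hv : v = w
        · have : v ≠ w' := by
            rintro rfl
            exact (hadj v).ne (hv.trans hw'.symm)
          simp [hv, hv ▸ this]
        · simp [hv, Ne.symm hv]
    _ = 1 := by
        rw [Finset.sum_add_distrib]
        simp
        norm_num

open Classical in
/-- A point of the perfect matching polytope is supported by some perfect matching. -/
theorem exists_isPerfectMatching_of_mem_polytope [Fintype V] {x : G.edgeSet → ℝ}
    (hx : x ∈ perfectMatchingPolytope G) :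
    ∃ M : G.Subgraph, M.IsPerfectMatching ∧ ∀ e : G.edgeSet, (e : Sym2 V) ∈ M.edgeSet → x e ≠ 0 := by
  by_contra hcon
  push Not at hcon
  -- The separating functional sums the coordinates outside the support of `x`. If no perfect
  -- matching lies inside the support, it is positive on every incidence vector, hence on the hull,
  -- yet it vanishes at `x`.
  have hsub : perfectMatchingPolytope G ⊆ {y | 0 < ∑ e, if x e = 0 then y e else 0} := by
    refine convexHull_min ?_ ?_
    · rintro y ⟨M, hM, rfl⟩
      obtain ⟨e, he, he'⟩ := hcon M hM
      change (0 : ℝ) < ∑ e, if x e = 0 then incidenceVector M e else 0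
      refine Finset.sum_pos' (fun e' _ => ?_) ⟨e, Finset.mem_univ _, ?_⟩
      · unfold incidenceVector
        split_ifs <;> norm_num
      · simp [he', incidenceVector, he]
    · intro y hy z hz a b ha hb hab
      simp only [mem_ofPred_eq] at *
      have : (∑ e, if x e = 0 then (a • y + b • z) e else 0) =
          a * (∑ e, if x e = 0 then y e else 0) + b * ∑ e, if x e = 0 then z e else 0 := by
        rw [Finset.mul_sum, Finset.mul_sum, ← Finset.sum_add_distrib]
        refine Finset.sum_congr rfl fun e _ => ?_
        split_ifs <;> simp
      rw [this]
      rcases ha.eq_or_lt with rfl | ha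
      · have : b = 1 := by linarith
        subst this
        linarith
      · have h1 := mul_pos ha hy
        have h2 := mul_nonneg hb hz.le
        linarith
  have := hsub hx
  simp only [mem_ofPred_eq] at this
  rw [Finset.sum_eq_zero] at this
  · exact lt_irrefl _ this
  · intro e _
    split_ifs with h
    · exact h
    · rfl

theorem even_ncard_of_involution [Finite V] {t : V → V} (ht : ∀ v, t (t v) = v) (ht' : ∀ v, t v ≠ v)
    {A : Set V} (hA : ∀ v ∈ A, t v ∈ A) : Even A.ncard := by
  classical
  have := Fintype.ofFinite V
  rw [Set.ncard_eq_toFinset_card']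
  have h : ∑ _v ∈ A.toFinset, (1 : ZMod 2) = 0 := by
    refine Finset.sum_involution (fun v _ => t v) ?_ ?_ ?_ ?_
    · intro v _; decide
    · intro v _ _; exact ht' v
    · intro v hv; simpa using hA v (by simpa using hv)
    · intro v _; exact ht v
  rw [Finset.sum_const, nsmul_eq_mul, mul_one] at h
  exact (ZMod.natCast_eq_zero_iff_even).1 h

/-- The half-integral point of `s` belongs to the perfect matching polytope, so some perfect
matching uses only edges `v, s v`. Since `s` permutes `A`, these edges do not leave `A`, and the
matching pairs up the vertices of `A`. -/
theorem IsBN.even_ncard [Fintype V] (h : IsBN G) {s : V → V} (hs : Function.Injective s)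
    (hadj : ∀ v, G.Adj v (s v)) {A : Set V} (hA : MapsTo s A A) : Even A.ncard := by
  classical
  have hx := mem_fractionalMatchingPolytope hs hadj
  rw [← h.2] at hx
  obtain ⟨M, hM, hMe⟩ := exists_isPerfectMatching_of_mem_polytope hx
  obtain ⟨t, ht, ht'⟩ := exists_involution_of_isPerfectMatching hM
  refine even_ncard_of_involution (fun v => (ht' v).2) (fun v => (ht' v).1.ne') fun v hv => ?_
  have h1 := hMe ⟨s(v, t v), (ht' v).1⟩ ((ht v _).2 rfl)
  have h2 : ∃ u, s(u, s u) = s(v, t v) := by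
    by_contra hne
    push Not at hne
    exact h1 (Finset.sum_eq_zero fun u _ => if_neg (hne u))
  obtain ⟨u, hu⟩ := h2
  rw [Sym2.eq_iff] at hu
  rcases hu with ⟨rfl, h3⟩ | ⟨h3, h4⟩
  · exact h3 ▸ hA hv
  -- The matching edge is traversed towards `v`, so invariance under the inverse of `s` is needed;
  -- it follows from finiteness.
  · have himg : s '' A = A := by
      refine Set.eq_of_subset_of_ncard_le hA.image_subset ?_ (Set.toFinite _)
      rw [Set.ncard_image_of_injective _ hs]
    obtain ⟨a, ha, hav⟩ : v ∈ s '' A := himg.symm ▸ hv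
    rw [← h3, hs (h4.trans hav.symm)]
    exact ha

/-- In a Birkhoff-von Neumann graph, no two disjoint odd cycles have a matchable complement. -/
theorem IsBN.not_odd_of_cycleCoverable [Fintype V] (h : IsBN G) {c : ℕ → V} {n : ℕ}
    (hc : IsCyc G c n) (hn : Odd n) (hcov : CycleCoverable G (c '' Iio n)ᶜ) : False := by
  obtain ⟨s, hs, -, hinj, hadj⟩ := hc.cycleCoverable.exists_union hcov disjoint_compl_right
  rw [union_compl_self, injOn_univ] at hinj
  have := h.even_ncard hinj (fun v => hadj v (by simp)) hs
  rw [hc.inj.ncard_image, ← Finset.coe_Iio, Set.ncard_coe_finset, Nat.card_Iio] at this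
  exact (Nat.not_even_iff_odd.2 hn) this

/-! ### Conformal bisubdivisions given by vertex labels -/

/-- A conformal bisubdivision of the multigraph with vertices `0, ..., k - 1` and list of edges `E`.
The label of a vertex of `G` tells which branch vertex it is, or on which of the paths it is an
inner vertex; vertices outside the bisubdivision have no label. -/
structure Frame (G : SimpleGraph V) (k : ℕ) (E : List (ℕ × ℕ)) (f : ℕ → V)
    (lab : V → Option (ℕ ⊕ ℕ)) : Prop where
  vertex : ∀ w < k, ∀ x, lab x = some (Sum.inl w) ↔ x = f w
  vertex_lt : ∀ x w, lab x = some (Sum.inl w) → w < k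
  edge_lt : ∀ x i, lab x = some (Sum.inr i) → i < E.length
  path : ∀ i a b, E[i]? = some (a, b) → a < k ∧ b < k ∧
    ∃ n, Odd n ∧ HasPath G (f a) (f b) n {x | lab x = some (Sum.inr i)}
  matchable : MatchableOn G {x | lab x = none}

/-- The inner vertices of the path of the edge with number `i`. -/
def inner (lab : V → Option (ℕ ⊕ ℕ)) (i : ℕ) : Set V := {x | lab x = some (Sum.inr i)}

/-- The first two inner vertices of a subdivided path become the branch vertices `k` and `k + 1`.
Overwriting the entry `i` by the rest of the path and appending the two new edges keeps the numbers
of all other edges, so the step can be repeated. -/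
theorem Frame.subdivide {k : ℕ} {E : List (ℕ × ℕ)} {f : ℕ → V} {lab : V → Option (ℕ ⊕ ℕ)}
    (h : Frame G k E f lab) {i a b : ℕ} (hi : E[i]? = some (a, b)) (hne : (inner lab i).Nonempty) :
    ∃ f' lab', Frame G (k + 2) (E.set i (k + 1, b) ++ [(a, k), (k, k + 1)]) f' lab' ∧
      ∀ j ≠ i, inner lab' j = inner lab j := by
  classical
  obtain ⟨ha, hb, n, hn, hp⟩ := h.path i a b hi
  obtain ⟨y, z, n', hn', hy, hz, hyz, hay, hyz', hp'⟩ := hp.split hn hne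
  replace hy : lab y = some (Sum.inr i) := hy
  replace hz : lab z = some (Sum.inr i) := hz
  have hil : i < E.length := h.edge_lt y i hy
  have hf : ∀ w < k, lab (f w) = some (Sum.inl w) := fun w hw => (h.vertex w hw _).2 rfl
  have hfy : ∀ w < k, f w ≠ y := fun w hw he => by
    have := hf w hw
    rw [he, hy] at this
    simp at this
  have hfz : ∀ w < k, f w ≠ z := fun w hw he => by
    have := hf w hw
    rw [he, hz] at this
    simp at this
  set f' : ℕ → V := fun w => if w = k then y else if w = k + 1 then z else f w with hf'
  set lab' : V → Option (ℕ ⊕ ℕ) := fun x => if x = y then some (Sum.inl k) else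
    if x = z then some (Sum.inl (k + 1)) else lab x with hlab'
  have hf'w : ∀ w < k, f' w = f w := fun w hw => by
    simp [hf', show w ≠ k by omega, show w ≠ k + 1 by omega]
  have hf'k : f' k = y := by simp [hf']
  have hf'k1 : f' (k + 1) = z := by simp [hf']
  have hly : lab' y = some (Sum.inl k) := by simp [hlab']
  have hlz : lab' z = some (Sum.inl (k + 1)) := by simp [hlab', hyz.symm]
  have hlo : ∀ x, x ≠ y → x ≠ z → lab' x = lab x := fun x h1 h2 => by simp [hlab', h1, h2]
  have hlj : ∀ j, {x | lab' x = some (Sum.inr j)} = {x | lab x = some (Sum.inr j)} \ {y, z} := by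
    intro j
    ext x
    change lab' x = _ ↔ lab x = _ ∧ ¬ (x = y ∨ x = z)
    by_cases h1 : x = y
    · simp [h1, hly]
    by_cases h2 : x = z
    · simp [h2, hlz]
    simp [h1, h2, hlo]
  have hlj' : ∀ j ≠ i, {x | lab' x = some (Sum.inr j)} = {x | lab x = some (Sum.inr j)} := by
    intro j hj
    rw [hlj]
    refine sdiff_eq_left.2 (Set.disjoint_left.2 ?_)
    rintro x hx (rfl | rfl)
    · replace hx : lab x = _ := hx
      simp [hy, hj.symm] at hx
    · replace hx : lab x = _ := hx
      simp [hz, hj.symm] at hx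
  have hempty : ∀ j, E.length ≤ j → {x | lab' x = some (Sum.inr j)} = ∅ := by
    intro j hj
    rw [hlj' j (by omega)]
    refine Set.eq_empty_of_forall_notMem fun x hx => ?_
    exact absurd (h.edge_lt x j hx) (by omega)
  refine ⟨f', lab', ⟨?_, ?_, ?_, ?_, ?_⟩, hlj'⟩
  · intro w hw x
    by_cases h1 : x = y
    · subst h1
      rw [hly]
      rcases (show w < k ∨ w = k ∨ w = k + 1 by omega) with h2 | rfl | rfl
      · rw [hf'w w h2]
        simp [h2.ne', (hfy w h2).symm]
      · simp [hf'k]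
      · simp [hf'k1, hyz]
    by_cases h2 : x = z
    · subst h2
      rw [hlz]
      rcases (show w < k ∨ w = k ∨ w = k + 1 by omega) with h2 | rfl | rfl
      · rw [hf'w w h2]
        simp [show k + 1 ≠ w by omega, (hfz w h2).symm]
      · simp [hf'k, h1]
      · simp [hf'k1]
    rw [hlo x h1 h2]
    rcases (show w < k ∨ w = k ∨ w = k + 1 by omega) with h3 | rfl | rfl
    · rw [hf'w w h3, h.vertex w h3]
    · rw [hf'k]
      exact iff_of_false (fun h' => absurd (h.vertex_lt _ _ h') (by omega)) h1
    · rw [hf'k1]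
      exact iff_of_false (fun h' => absurd (h.vertex_lt _ _ h') (by omega)) h2
  · intro x w hx
    by_cases h1 : x = y
    · rw [h1, hly] at hx
      simp only [Option.some.injEq, Sum.inl.injEq] at hx
      omega
    by_cases h2 : x = z
    · rw [h2, hlz] at hx
      simp only [Option.some.injEq, Sum.inl.injEq] at hx
      omega
    rw [hlo x h1 h2] at hx
    have := h.vertex_lt x w hx
    omega
  · intro x j hx
    have : x ∈ {x | lab' x = some (Sum.inr j)} := hx
    rw [hlj] at this
    have := h.edge_lt x j this.1
    simp
    omega
  · intro j a' b' hj
    rcases Nat.lt_or_ge j E.length with h1 | h1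
    · rw [List.getElem?_append_left (by simpa using h1)] at hj
      by_cases hji : j = i
      · subst hji
        rw [List.getElem?_set_self h1] at hj
        simp only [Option.some.injEq, Prod.mk.injEq] at hj
        obtain ⟨rfl, rfl⟩ := hj
        refine ⟨by omega, by omega, n', hn', ?_⟩
        rw [hf'k1, hf'w b hb, hlj]
        exact hp'
      · rw [List.getElem?_set_ne (Ne.symm hji)] at hj
        obtain ⟨h2, h3, n'', h4, h5⟩ := h.path j a' b' hj
        refine ⟨by omega, by omega, n'', h4, ?_⟩
        rwa [hf'w _ h2, hf'w _ h3, hlj' j hji]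
    · rw [List.getElem?_append_right (by simpa using h1), List.length_set] at hj
      obtain ⟨d, rfl⟩ := Nat.exists_eq_add_of_le h1
      rw [Nat.add_sub_cancel_left] at hj
      rw [hempty _ h1]
      match d with
      | 0 =>
        simp only [List.getElem?_cons_zero, Option.some.injEq, Prod.mk.injEq] at hj
        obtain ⟨rfl, rfl⟩ := hj
        refine ⟨by omega, by omega, 1, odd_one, ?_⟩
        rw [hf'w _ ha, hf'k]
        exact HasPath.single hay
      | 1 =>
        simp only [List.getElem?_cons_succ, List.getElem?_cons_zero, Option.some.injEq,
          Prod.mk.injEq] at hj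
        obtain ⟨rfl, rfl⟩ := hj
        refine ⟨by omega, by omega, 1, odd_one, ?_⟩
        rw [hf'k, hf'k1]
        exact HasPath.single hyz'
      | d + 2 => simp at hj
  · convert h.matchable using 1
    ext x
    change lab' x = none ↔ lab x = none
    by_cases h1 : x = y
    · simp [h1, hly, hy]
    by_cases h2 : x = z
    · simp [h2, hlz, hz]
    rw [hlo x h1 h2]

/-- Frames allow parallel edges, whereas `J` is simple; `hE` ensures that each edge of `J` has just
one path. -/
theorem Frame.isConformalMinor {k : ℕ} {E : List (ℕ × ℕ)} {f : ℕ → V} {lab : V → Option (ℕ ⊕ ℕ)}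
    (h : Frame G k E f lab) (J : SimpleGraph (Fin k))
    (hJ : ∀ u v : Fin k, J.Adj u v ↔ ((u : ℕ), (v : ℕ)) ∈ E ∨ ((v : ℕ), (u : ℕ)) ∈ E)
    (hE : (E.map fun e => s(e.1, e.2)).Nodup) : IsConformalMinor J G := by
  have hfi : ∀ w < k, lab (f w) = some (Sum.inl w) := fun w hw => (h.vertex w hw _).2 rfl
  have hexists : ∀ u v : Fin k, J.Adj u v → ∃ p : G.Walk (f u) (f v), p.IsPath ∧ Odd p.length ∧
      ∀ x, x ∈ p.support ↔ x = f u ∨ x = f v ∨ ∃ i a b, E[i]? = some (a, b) ∧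
        s(a, b) = s((u : ℕ), (v : ℕ)) ∧ lab x = some (Sum.inr i) := by
    have key : ∀ u v : Fin k, ((u : ℕ), (v : ℕ)) ∈ E →
        ∃ p : G.Walk (f u) (f v), p.IsPath ∧ Odd p.length ∧
        ∀ x, x ∈ p.support ↔ x = f u ∨ x = f v ∨ ∃ i a b, E[i]? = some (a, b) ∧
          s(a, b) = s((u : ℕ), (v : ℕ)) ∧ lab x = some (Sum.inr i) := by
      intro u v huv
      obtain ⟨i, hi⟩ := List.mem_iff_getElem?.1 huv
      obtain ⟨-, -, n, hn, hp⟩ := h.path i _ _ hi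
      obtain ⟨p, hp', rfl, hs⟩ := hp.exists_walk
      refine ⟨p, hp', hn, fun x => ?_⟩
      rw [hs]
      refine or_congr_right (or_congr_right ⟨fun hx => ⟨i, _, _, hi, rfl, hx⟩, ?_⟩)
      rintro ⟨j, a, b, hj, hab, hx⟩
      have hij : i = j := by
        have hi' : i < (E.map fun e => s(e.1, e.2)).length := by
          simpa using (List.getElem?_eq_some_iff.1 hi).1
        refine (List.getElem?_inj hi' hE).1 ?_
        simp [List.getElem?_map, hi, hj, hab]
      exact hij ▸ hx
    intro u v huv
    rcases (hJ u v).1 huv with h1 | h1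
    · exact key u v h1
    · obtain ⟨p, hp, hl, hs⟩ := key v u h1
      refine ⟨p.reverse, hp.reverse, by simpa using hl, fun x => ?_⟩
      rw [SimpleGraph.Walk.support_reverse, List.mem_reverse, hs, Sym2.eq_swap (a := (u : ℕ))]
      tauto
  choose W hW hWl hWs using hexists
  -- The walks chosen for `uv` and `vu` are unrelated, so one orientation is kept and the other is
  -- defined as its reverse.
  let p : ∀ u v : Fin k, J.Adj u v → G.Walk (f u) (f v) := fun u v huv =>
    if u < v then W u v huv else (W v u huv.symm).reverse
  have hp : ∀ u v huv, (p u v huv).IsPath ∧ Odd (p u v huv).length ∧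
      ∀ x, x ∈ (p u v huv).support ↔ x = f u ∨ x = f v ∨ ∃ i a b, E[i]? = some (a, b) ∧
        s(a, b) = s((u : ℕ), (v : ℕ)) ∧ lab x = some (Sum.inr i) := by
    intro u v huv
    by_cases hlt : u < v
    · simp only [p, hlt, if_true]
      exact ⟨hW _ _ _, hWl _ _ _, hWs _ _ _⟩
    · simp only [p, hlt, if_false]
      refine ⟨(hW _ _ _).reverse, by simpa using hWl v u huv.symm, fun x => ?_⟩
      rw [SimpleGraph.Walk.support_reverse, List.mem_reverse, hWs, Sym2.eq_swap (a := (u : ℕ))]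
      tauto
  have hps : ∀ u v huv x, x ∈ (p u v huv).support ↔ x = f u ∨ x = f v ∨
      ∃ i a b, E[i]? = some (a, b) ∧ s(a, b) = s((u : ℕ), (v : ℕ)) ∧ lab x = some (Sum.inr i) :=
    fun u v huv => (hp u v huv).2.2
  let H : G.Subgraph :=
    { verts := range (fun u : Fin k => f u) ∪ {x | ∃ u v, ∃ h : J.Adj u v, x ∈ (p u v h).support}
      Adj := fun x y => ∃ u v, ∃ h : J.Adj u v, s(x, y) ∈ (p u v h).edges
      adj_sub := by
        rintro x y ⟨u, v, huv, he⟩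
        exact (p u v huv).adj_of_mem_edges he
      edge_vert := by
        rintro x y ⟨u, v, huv, he⟩
        exact Or.inr ⟨u, v, huv, (p u v huv).fst_mem_support_of_mem_edges he⟩
      symm := ⟨by
        rintro x y ⟨u, v, huv, he⟩
        exact ⟨u, v, huv, Sym2.eq_swap ▸ he⟩⟩ }
  refine ⟨H, ⟨fun u => f u, p, ?_, fun u v huv => ⟨(hp u v huv).1, (hp u v huv).2.1⟩, ?_, ?_, ?_,
    rfl, ?_⟩, ?_⟩
  · intro u v huv
    have h1 := hfi u u.2
    rw [show f u = f v from huv, hfi v v.2] at h1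
    exact Fin.ext (by simpa using h1.symm)
  · intro u v huv
    rcases lt_trichotomy u v with h1 | rfl | h1
    · simp only [p, h1, if_true, not_lt.2 h1.le, if_false]
    · exact (huv.ne rfl).elim
    · simp only [p, h1, if_true, not_lt.2 h1.le, if_false, SimpleGraph.Walk.reverse_reverse]
  · intro u v huv w hw
    rw [hps] at hw
    rcases hw with hw | hw | ⟨i, a, b, -, -, hw⟩
    · left
      have h1 := hfi w w.2
      rw [show f w = f u from hw, hfi u u.2] at h1
      exact Fin.ext (by simpa using h1.symm)
    · right
      have h1 := hfi w w.2
      rw [show f w = f v from hw, hfi v v.2] at h1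
      exact Fin.ext (by simpa using h1.symm)
    · rw [hfi w w.2] at hw
      simp at hw
  · intro u v huv u' v' huv' hne x hx hx'
    rw [hps] at hx hx'
    rcases hx with rfl | rfl | ⟨i, a, b, hi, hab, hx⟩
    · exact ⟨u, rfl⟩
    · exact ⟨v, rfl⟩
    rcases hx' with rfl | rfl | ⟨i', a', b', hi', hab', hx'⟩
    · exact ⟨u', rfl⟩
    · exact ⟨v', rfl⟩
    exfalso
    rw [hx] at hx'
    obtain rfl : i = i' := by simpa using hx'
    rw [hi] at hi'
    obtain ⟨rfl, rfl⟩ : a = a' ∧ b = b' := by simpa using hi'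
    refine hne ?_
    rw [hab] at hab'
    simpa [Sym2.eq_iff, Fin.ext_iff] using hab'
  · ext e
    induction e with
    | _ x y => rfl
  · have hV : H.vertsᶜ = {x | lab x = none} := by
      ext x
      change ¬ (x ∈ range _ ∨ ∃ u v, ∃ h : J.Adj u v, x ∈ (p u v h).support) ↔ lab x = none
      rw [not_iff_comm]
      constructor
      · intro hx
        obtain ⟨l, hl⟩ := Option.ne_none_iff_exists'.1 hx
        rcases l with w | i
        · have hw := h.vertex_lt x w hl
          exact Or.inl ⟨⟨w, hw⟩, ((h.vertex w hw x).1 hl).symm⟩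
        · have hi := h.edge_lt x i hl
          have hi' : E[i]? = some (E[i].1, E[i].2) := List.getElem?_eq_getElem hi
          obtain ⟨ha, hb, -⟩ := h.path i _ _ hi'
          have hadj : J.Adj ⟨_, ha⟩ ⟨_, hb⟩ := (hJ _ _).2 (Or.inl (List.mem_of_getElem? hi'))
          exact Or.inr ⟨_, _, hadj, (hps _ _ hadj x).2 (Or.inr (Or.inr ⟨i, _, _, hi', rfl, hl⟩))⟩
      · rintro (⟨u, rfl⟩ | ⟨u, v, huv, hx⟩)
        · simp [hfi u u.2]
        · rw [hps] at hx
          rcases hx with rfl | rfl | ⟨i, -, -, -, -, hx⟩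
          · simp [hfi u u.2]
          · simp [hfi v v.2]
          · simp [hx]
    unfold IsConformal
    rw [hV]
    exact h.matchable.isMatchable

/-! ### The excluded graphs as subdivided thetas and subdivided copies of `K₄`. -/

theorem isConformalMinor_graphA1 {f : ℕ → V} {lab : V → Option (ℕ ⊕ ℕ)}
    (h : Frame G 2 [(0, 1), (0, 1), (0, 1)] f lab) (h0 : (inner lab 0).Nonempty)
    (h1 : (inner lab 1).Nonempty) (h2 : (inner lab 2).Nonempty) :
    IsConformalMinor graphA1 G := by
  obtain ⟨f1, l1, F1, e1⟩ := h.subdivide (i := 0) rfl h0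
  obtain ⟨f2, l2, F2, e2⟩ := F1.subdivide (i := 1) rfl (by rwa [e1 1 (by decide)])
  obtain ⟨f3, l3, F3, e3⟩ := F2.subdivide (i := 2) rfl
    (by rwa [e2 2 (by decide), e1 2 (by decide)])
  refine F3.isConformalMinor graphA1 ?_ (by decide)
  simp only [graphA1, SimpleGraph.fromEdgeSet_adj, mem_insert_iff, mem_singleton_iff]
  decide

theorem isConformalMinor_graphD1 {f : ℕ → V} {lab : V → Option (ℕ ⊕ ℕ)}
    (h : Frame G 4 [(0, 1), (0, 2), (0, 3), (1, 2), (1, 3), (2, 3)] f lab)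
    (h0 : (inner lab 0).Nonempty) (h1 : (inner lab 1).Nonempty) (h2 : (inner lab 2).Nonempty) :
    IsConformalMinor graphD1 G := by
  obtain ⟨f1, l1, F1, e1⟩ := h.subdivide (i := 0) rfl h0
  obtain ⟨f2, l2, F2, e2⟩ := F1.subdivide (i := 1) rfl (by rwa [e1 1 (by decide)])
  obtain ⟨f3, l3, F3, e3⟩ := F2.subdivide (i := 2) rfl
    (by rwa [e2 2 (by decide), e1 2 (by decide)])
  refine F3.isConformalMinor graphD1 ?_ (by decide)
  simp only [graphD1, SimpleGraph.fromEdgeSet_adj, mem_insert_iff, mem_singleton_iff]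
  decide

theorem isConformalMinor_graphD2 {f : ℕ → V} {lab : V → Option (ℕ ⊕ ℕ)}
    (h : Frame G 4 [(0, 1), (0, 2), (0, 3), (1, 2), (1, 3), (2, 3)] f lab)
    (h3 : (inner lab 3).Nonempty) (h4 : (inner lab 4).Nonempty) (h5 : (inner lab 5).Nonempty) :
    IsConformalMinor graphD2 G := by
  obtain ⟨f1, l1, F1, e1⟩ := h.subdivide (i := 3) rfl h3
  -- Edge 5 comes before edge 4 so that the new vertices receive the numbers they have in `graphD2`.
  obtain ⟨f2, l2, F2, e2⟩ := F1.subdivide (i := 5) rfl (by rwa [e1 5 (by decide)])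
  obtain ⟨f3, l3, F3, e3⟩ := F2.subdivide (i := 4) rfl
    (by rwa [e2 4 (by decide), e1 4 (by decide)])
  refine F3.isConformalMinor graphD2 ?_ (by decide)
  simp only [graphD2, SimpleGraph.fromEdgeSet_adj, mem_insert_iff, mem_singleton_iff]
  decide

/-- There is a cycle of even length (possibly an edge) with vertex set `S`. -/
def EvenCycleOn (G : SimpleGraph V) (S : Set V) : Prop :=
  ∃ c n, IsCyc G c n ∧ 0 < n ∧ Even n ∧ c '' Iio n = S

theorem HasPath.evenCycleOn {u v : V} {n k : ℕ} {I J : Set V} (h : HasPath G u v n I)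
    (h' : HasPath G v u k J) (hn : n ≠ 0) (hk : k ≠ 0) (hnk : Even (n + k)) (hd : Disjoint I J) :
    EvenCycleOn G ({u, v} ∪ I ∪ J) := by
  obtain ⟨c, hc, hS⟩ := h.exists_isCyc h' hd hn hk
  exact ⟨c, n + k, hc, by omega, hnk, hS⟩

/-! ### Three paths with common ends -/

/-- If one of the paths is an edge, the other two form an even cycle through all vertices. Otherwise
each has at least two inner vertices, and the three paths are a conformal bisubdivision of
`graphA1`. -/
theorem evenCycleOn_of_theta {u v : V} {n₀ n₁ n₂ : ℕ} {I₀ I₁ I₂ : Set V}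
    (h₀ : HasPath G u v n₀ I₀) (h₁ : HasPath G u v n₁ I₁) (h₂ : HasPath G u v n₂ I₂)
    (o₀ : Odd n₀) (o₁ : Odd n₁) (o₂ : Odd n₂) (d₀₁ : Disjoint I₀ I₁) (d₀₂ : Disjoint I₀ I₂)
    (d₁₂ : Disjoint I₁ I₂) (huv : u ≠ v) (hne : I₀.Nonempty)
    (hm : MatchableOn G ({u, v} ∪ I₀ ∪ I₁ ∪ I₂)ᶜ) (hA1 : ¬ IsConformalMinor graphA1 G) :
    EvenCycleOn G ({u, v} ∪ I₀ ∪ I₁ ∪ I₂) := by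
  classical
  rcases eq_empty_or_nonempty I₁ with rfl | hne₁
  · rw [union_empty]
    exact h₀.evenCycleOn h₂.reverse o₀.pos.ne' o₂.pos.ne' (o₀.add_odd o₂) d₀₂
  rcases eq_empty_or_nonempty I₂ with rfl | hne₂
  · rw [union_empty]
    exact h₀.evenCycleOn h₁.reverse o₀.pos.ne' o₁.pos.ne' (o₀.add_odd o₁) d₀₁
  exfalso
  set lab : V → Option (ℕ ⊕ ℕ) := fun x => if x = u then some (Sum.inl 0) else
    if x = v then some (Sum.inl 1) else if x ∈ I₀ then some (Sum.inr 0) else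
    if x ∈ I₁ then some (Sum.inr 1) else if x ∈ I₂ then some (Sum.inr 2) else none with hlab
  have hu₀ := h₀.left_notMem
  have hu₁ := h₁.left_notMem
  have hu₂ := h₂.left_notMem
  have hv₀ := h₀.right_notMem
  have hv₁ := h₁.right_notMem
  have hv₂ := h₂.right_notMem
  have e₀ : ∀ x, lab x = some (Sum.inr 0) ↔ x ∈ I₀ := by
    intro x
    simp only [hlab]
    grind
  have e₁ : ∀ x, lab x = some (Sum.inr 1) ↔ x ∈ I₁ := by
    intro x
    have := fun h : x ∈ I₀ => Set.disjoint_left.1 d₀₁ h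
    simp only [hlab]
    grind
  have e₂ : ∀ x, lab x = some (Sum.inr 2) ↔ x ∈ I₂ := by
    intro x
    have := fun h : x ∈ I₀ => Set.disjoint_left.1 d₀₂ h
    have := fun h : x ∈ I₁ => Set.disjoint_left.1 d₁₂ h
    simp only [hlab]
    grind
  have f₀ : ∀ x, lab x = some (Sum.inl 0) ↔ x = u := by
    intro x
    simp only [hlab]
    grind
  have f₁ : ∀ x, lab x = some (Sum.inl 1) ↔ x = v := by
    intro x
    simp only [hlab]
    grind
  have F : Frame G 2 [(0, 1), (0, 1), (0, 1)] (fun i => if i = 0 then u else v) lab := by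
    refine ⟨?_, ?_, ?_, ?_, ?_⟩
    · intro w hw x
      interval_cases w
      · simpa using f₀ x
      · simpa using f₁ x
    · intro x w hx
      simp only [hlab] at hx
      split_ifs at hx <;> simp at hx <;> omega
    · intro x i hx
      simp only [hlab] at hx
      split_ifs at hx <;> simp at hx <;> simp <;> omega
    · intro i a b hi
      match i with
      | 0 =>
        obtain ⟨rfl, rfl⟩ : 0 = a ∧ 1 = b := by simpa using hi
        simp only [e₀]
        exact ⟨by omega, by omega, n₀, o₀, by simpa using h₀⟩
      | 1 =>
        obtain ⟨rfl, rfl⟩ : 0 = a ∧ 1 = b := by simpa using hi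
        simp only [e₁]
        exact ⟨by omega, by omega, n₁, o₁, by simpa using h₁⟩
      | 2 =>
        obtain ⟨rfl, rfl⟩ : 0 = a ∧ 1 = b := by simpa using hi
        simp only [e₂]
        exact ⟨by omega, by omega, n₂, o₂, by simpa using h₂⟩
      | i + 3 => simp at hi
    · convert hm using 1
      ext x
      change lab x = none ↔ ¬ _
      simp only [hlab, mem_union, mem_insert_iff, mem_singleton_iff]
      split_ifs with a b c d e
      · simp [a]
      · simp [b]
      · simp [c]
      · simp [d]
      · simp [e]
      · simp [a, b, c, d, e]
  refine hA1 (isConformalMinor_graphA1 F ?_ ?_ ?_)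
  · exact hne.imp fun x hx => (e₀ x).2 hx
  · exact hne₁.imp fun x hx => (e₁ x).2 hx
  · exact hne₂.imp fun x hx => (e₂ x).2 hx

/-! ### Bisubdivisions of the complete graph on four vertices -/

/-- A conformal bisubdivision of `K₄`, described by labels of the vertices of `G`: the label of the
branch vertex `f w` is `s(w, w)`, that of an inner vertex of the path of the edge `uv` is
`s(u, v)`. -/
structure K4Frame (G : SimpleGraph V) (f : Fin 4 → V) (lab : V → Option (Sym2 (Fin 4))) :
    Prop where
  vertex : ∀ w x, lab x = some s(w, w) ↔ x = f w
  path : ∀ u v, u ≠ v → ∃ n, Odd n ∧ HasPath G (f u) (f v) n {x | lab x = some s(u, v)}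
  matchable : MatchableOn G {x | lab x = none}

/-- The symmetry of `K₄` lets later arguments treat one vertex or one pair of opposite edges. -/
theorem K4Frame.perm {f : Fin 4 → V} {lab : V → Option (Sym2 (Fin 4))} (h : K4Frame G f lab)
    (σ : Equiv.Perm (Fin 4)) :
    K4Frame G (f ∘ σ) fun x => (lab x).map (Sym2.map σ.symm) := by
  have key : ∀ x u v, (lab x).map (Sym2.map σ.symm) = some s(u, v) ↔ lab x = some s(σ u, σ v) := by
    intro x u v
    rw [Option.map_eq_some_iff]
    constructor
    · rintro ⟨e, he, hs⟩
      rw [he, ← Sym2.map_mk, ← hs, Sym2.map_map]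
      simp
    · intro hx
      exact ⟨_, hx, by simp⟩
  refine ⟨?_, ?_, ?_⟩
  · intro w x
    rw [key]
    exact h.vertex _ _
  · intro u v huv
    simp only [key]
    exact h.path _ _ fun he => huv (σ.injective he)
  · simpa using h.matchable

/-- Numbering of the vertices and edges of `K₄`. -/
def code (e : Sym2 (Fin 4)) : ℕ ⊕ ℕ :=
  if e = s(0, 0) then Sum.inl 0 else if e = s(1, 1) then Sum.inl 1 else
  if e = s(2, 2) then Sum.inl 2 else if e = s(3, 3) then Sum.inl 3 else
  if e = s(0, 1) then Sum.inr 0 else if e = s(0, 2) then Sum.inr 1 else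
  if e = s(0, 3) then Sum.inr 2 else if e = s(1, 2) then Sum.inr 3 else
  if e = s(1, 3) then Sum.inr 4 else Sum.inr 5

theorem code_injective : Function.Injective code := by decide

theorem code_lt (e : Sym2 (Fin 4)) :
    (∃ w < 4, code e = Sum.inl w) ∨ ∃ i < 6, code e = Sum.inr i := by
  revert e; decide

theorem K4Frame.frame {f : Fin 4 → V} {lab : V → Option (Sym2 (Fin 4))} (h : K4Frame G f lab) :
    Frame G 4 [(0, 1), (0, 2), (0, 3), (1, 2), (1, 3), (2, 3)]
      (fun w => f (Fin.ofNat 4 w)) fun x => (lab x).map code := by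
  have key : ∀ x l e, code e = l → ((lab x).map code = some l ↔ lab x = some e) := by
    rintro x l e rfl
    rw [← Option.map_some, (Option.map_injective code_injective).eq_iff]
  have hpath : ∀ (i : ℕ) (a b : Fin 4), a ≠ b → code s(a, b) = Sum.inr i →
      ∃ n, Odd n ∧ HasPath G (f a) (f b) n {x | (lab x).map code = some (Sum.inr i)} := by
    intro i a b hab hi
    simp only [key _ _ _ hi]
    exact h.path a b hab
  refine ⟨?_, ?_, ?_, ?_, by simpa using h.matchable⟩
  · intro w hw x
    rw [key x _ s(Fin.ofNat 4 w, Fin.ofNat 4 w) (by interval_cases w <;> decide)]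
    exact h.vertex _ _
  · intro x w hx
    obtain ⟨e, -, he⟩ := Option.map_eq_some_iff.1 hx
    rcases code_lt e with ⟨w', hw', h1⟩ | ⟨i, hi, h1⟩
    · rw [h1] at he
      simp at he
      omega
    · simp [h1] at he
  · intro x i hx
    obtain ⟨e, -, he⟩ := Option.map_eq_some_iff.1 hx
    rcases code_lt e with ⟨w', hw', h1⟩ | ⟨i', hi, h1⟩
    · simp [h1] at he
    · rw [h1] at he
      simp at he
      simp
      omega
  · intro i a b hi
    match i with
    | 0 =>
      obtain ⟨rfl, rfl⟩ : 0 = a ∧ 1 = b := by simpa using hi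
      exact ⟨by omega, by omega, hpath 0 0 1 (by decide) (by decide)⟩
    | 1 =>
      obtain ⟨rfl, rfl⟩ : 0 = a ∧ 2 = b := by simpa using hi
      exact ⟨by omega, by omega, hpath 1 0 2 (by decide) (by decide)⟩
    | 2 =>
      obtain ⟨rfl, rfl⟩ : 0 = a ∧ 3 = b := by simpa using hi
      exact ⟨by omega, by omega, hpath 2 0 3 (by decide) (by decide)⟩
    | 3 =>
      obtain ⟨rfl, rfl⟩ : 1 = a ∧ 2 = b := by simpa using hi
      exact ⟨by omega, by omega, hpath 3 1 2 (by decide) (by decide)⟩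
    | 4 =>
      obtain ⟨rfl, rfl⟩ : 1 = a ∧ 3 = b := by simpa using hi
      exact ⟨by omega, by omega, hpath 4 1 3 (by decide) (by decide)⟩
    | 5 =>
      obtain ⟨rfl, rfl⟩ : 2 = a ∧ 3 = b := by simpa using hi
      exact ⟨by omega, by omega, hpath 5 2 3 (by decide) (by decide)⟩
    | i + 6 => simp at hi

theorem K4Frame.inner_frame {lab : V → Option (Sym2 (Fin 4))} {i : ℕ} {e : Sym2 (Fin 4)}
    (hi : code e = Sum.inr i) (h : ∃ x, lab x = some e) :
    (inner (fun x => (lab x).map code) i).Nonempty := by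
  obtain ⟨x, hx⟩ := h
  exact ⟨x, show (lab x).map code = _ by simp [hx, hi]⟩

theorem K4Frame.isConformalMinor_graphD1 {f : Fin 4 → V} {lab : V → Option (Sym2 (Fin 4))}
    (h : K4Frame G f lab) (v : Fin 4) (hv : ∀ u, u ≠ v → ∃ x, lab x = some s(v, u)) :
    IsConformalMinor graphD1 G := by
  have hs : ∀ u, u ≠ 0 →
      ∃ x, (lab x).map (Sym2.map (Equiv.swap 0 v).symm) = some s(0, u) := by
    intro u hu
    obtain ⟨x, hx⟩ := hv (Equiv.swap 0 v u) fun he => hu (by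
      rw [← Equiv.swap_apply_left 0 v] at he
      exact (Equiv.swap 0 v).injective he)
    exact ⟨x, by simp [hx]⟩
  exact BNGraph.isConformalMinor_graphD1 (h.perm (Equiv.swap 0 v)).frame
    (inner_frame (e := s(0, 1)) (by decide) (hs 1 (by decide)))
    (inner_frame (e := s(0, 2)) (by decide) (hs 2 (by decide)))
    (inner_frame (e := s(0, 3)) (by decide) (hs 3 (by decide)))

theorem K4Frame.isConformalMinor_graphD2 {f : Fin 4 → V} {lab : V → Option (Sym2 (Fin 4))}
    (h : K4Frame G f lab) (v : Fin 4)
    (hv : ∀ u w, u ≠ v → w ≠ v → u ≠ w → ∃ x, lab x = some s(u, w)) :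
    IsConformalMinor graphD2 G := by
  have hsv : ∀ u, u ≠ 0 → Equiv.swap 0 v u ≠ v := fun u hu he => hu (by
    rw [← Equiv.swap_apply_left 0 v] at he
    exact (Equiv.swap 0 v).injective he)
  have hs : ∀ u w, u ≠ 0 → w ≠ 0 → u ≠ w →
      ∃ x, (lab x).map (Sym2.map (Equiv.swap 0 v).symm) = some s(u, w) := by
    intro u w hu hw huw
    obtain ⟨x, hx⟩ := hv (Equiv.swap 0 v u) (Equiv.swap 0 v w) (hsv u hu) (hsv w hw)
      ((Equiv.swap 0 v).injective.ne huw)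
    exact ⟨x, by simp [hx]⟩
  exact BNGraph.isConformalMinor_graphD2 (h.perm (Equiv.swap 0 v)).frame
    (inner_frame (e := s(1, 2)) (by decide) (hs 1 2 (by decide) (by decide) (by decide)))
    (inner_frame (e := s(1, 3)) (by decide) (hs 1 3 (by decide) (by decide) (by decide)))
    (inner_frame (e := s(2, 3)) (by decide) (hs 2 3 (by decide) (by decide) (by decide)))

/-- If two disjoint edges of `K₄` are not subdivided, then the bisubdivision has a Hamilton
cycle. -/
theorem K4Frame.evenCycleOn_of_opposite {f : Fin 4 → V} {lab : V → Option (Sym2 (Fin 4))}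
    (h : K4Frame G f lab) (h02 : ¬ ∃ x, lab x = some s(0, 2)) (h13 : ¬ ∃ x, lab x = some s(1, 3)) :
    EvenCycleOn G {x | lab x ≠ none} := by
  obtain ⟨n₁, o₁, p₁⟩ := h.path 0 1 (by decide)
  obtain ⟨n₂, o₂, p₂⟩ := h.path 1 2 (by decide)
  obtain ⟨n₃, o₃, p₃⟩ := h.path 2 3 (by decide)
  obtain ⟨n₄, o₄, p₄⟩ := h.path 3 0 (by decide)
  have hf : ∀ w, lab (f w) = some s(w, w) := fun w => (h.vertex w _).2 rfl
  have hdis : ∀ e e' : Sym2 (Fin 4), e ≠ e' →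
      Disjoint {x | lab x = some e} {x | lab x = some e'} := by
    intro e e' hne
    rw [Set.disjoint_left]
    intro x (hx : lab x = some e) (hx' : lab x = some e')
    rw [hx] at hx'
    exact hne (Option.some_inj.1 hx')
  have hnm : ∀ w e, s(w, w) ≠ e → f w ∉ {x | lab x = some e} := by
    intro w e hne (hx : lab (f w) = some e)
    rw [hf] at hx
    exact hne (Option.some_inj.1 hx)
  have hff : f 0 ≠ f 2 := by
    intro he
    have := hf 0
    rw [he, hf] at this
    exact absurd (Option.some_inj.1 this) (by decide)
  have q₁ := p₁.append p₂ (hdis _ _ (by decide)) (hnm _ _ (by decide)) (hnm _ _ (by decide)) hff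
    o₁.pos.ne' o₂.pos.ne'
  have q₂ := p₃.append p₄ (hdis _ _ (by decide)) (hnm _ _ (by decide)) (hnm _ _ (by decide))
    hff.symm o₃.pos.ne' o₄.pos.ne'
  have hset : ∀ w, {f w} = {x | lab x = some s(w, w)} := by
    intro w
    ext x
    exact (h.vertex w x).symm
  have := q₁.evenCycleOn q₂ (by have := o₁.pos; omega) (by have := o₃.pos; omega)
    ((o₁.add_odd o₂).add (o₃.add_odd o₄)) (by
      simp only [hset, Set.disjoint_union_left, Set.disjoint_union_right]
      refine ⟨⟨⟨⟨?_, ?_⟩, ?_⟩, ⟨?_, ?_⟩, ?_⟩, ⟨?_, ?_⟩, ?_⟩ <;> exact hdis _ _ (by decide))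
  convert this using 1
  ext x
  change lab x ≠ none ↔ _
  simp only [insert_eq, hset, mem_union]
  change _ ↔ ((lab x = _ ∨ lab x = _) ∨ (lab x = _ ∨ lab x = _) ∨ lab x = _) ∨
    (lab x = _ ∨ lab x = _) ∨ lab x = _
  have h02' := fun hx => h02 ⟨x, hx⟩
  have h13' := fun hx => h13 ⟨x, hx⟩
  -- Only the label of `x` matters now, so the equality of sets becomes a check over finitely many
  -- labels.
  clear this q₁ q₂ p₁ p₂ p₃ p₄
  generalize lab x = l at *
  revert l
  decide

/-- Without an even cycle through all vertices, every perfect matching of `K₄` contains a subdivided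
edge. One edge from each of the three matchings always gives a star or a triangle, hence `graphD1`
or `graphD2`. -/
theorem K4Frame.evenCycleOn {f : Fin 4 → V} {lab : V → Option (Sym2 (Fin 4))}
    (h : K4Frame G f lab) (hD1 : ¬ IsConformalMinor graphD1 G)
    (hD2 : ¬ IsConformalMinor graphD2 G) : EvenCycleOn G {x | lab x ≠ none} := by
  by_contra hcon
  have key : ∀ σ : Equiv.Perm (Fin 4), (∃ x, lab x = some s(σ 0, σ 2)) ∨
      ∃ x, lab x = some s(σ 1, σ 3) := by
    intro σ
    by_contra hσ
    rw [not_or] at hσ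
    refine hcon ?_
    have := (h.perm σ).evenCycleOn_of_opposite ?_ ?_
    · simpa using this
    · rintro ⟨x, hx⟩
      obtain ⟨e, he, hs⟩ := Option.map_eq_some_iff.1 hx
      refine hσ.1 ⟨x, ?_⟩
      rw [he, ← Sym2.map_mk, ← hs, Sym2.map_map]
      simp
    · rintro ⟨x, hx⟩
      obtain ⟨e, he, hs⟩ := Option.map_eq_some_iff.1 hx
      refine hσ.2 ⟨x, ?_⟩
      rw [he, ← Sym2.map_mk, ← hs, Sym2.map_map]
      simp
  -- These three permutations carry the pair 02, 13 to each of the three perfect matchings of `K₄`.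
  have k₁ : (∃ x, lab x = some s(0, 2)) ∨ ∃ x, lab x = some s(1, 3) := key 1
  have k₂ : (∃ x, lab x = some s(0, 1)) ∨ ∃ x, lab x = some s(2, 3) := key (Equiv.swap 1 2)
  have k₃ : (∃ x, lab x = some s(0, 3)) ∨ ∃ x, lab x = some s(1, 2) := key (Equiv.swap 2 3)
  have star := fun v => mt (h.isConformalMinor_graphD1 v) hD1
  have tri := fun v => mt (h.isConformalMinor_graphD2 v) hD2
  generalize hL : (fun e => ∃ x, lab x = some e) = L at *
  replace hL : ∀ e, (∃ x, lab x = some e) = L e := fun e => congrFun hL e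
  simp only [hL] at k₁ k₂ k₃ star tri
  have s₀ := star 0
  have s₁ := star 1
  have s₂ := star 2
  have s₃ := star 3
  have t₀ := tri 0
  have t₁ := tri 1
  have t₂ := tri 2
  have t₃ := tri 3
  have e10 : (s(1, 0) : Sym2 (Fin 4)) = s(0, 1) := Sym2.eq_swap
  have e20 : (s(2, 0) : Sym2 (Fin 4)) = s(0, 2) := Sym2.eq_swap
  have e30 : (s(3, 0) : Sym2 (Fin 4)) = s(0, 3) := Sym2.eq_swap
  have e21 : (s(2, 1) : Sym2 (Fin 4)) = s(1, 2) := Sym2.eq_swap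
  have e31 : (s(3, 1) : Sym2 (Fin 4)) = s(1, 3) := Sym2.eq_swap
  have e32 : (s(3, 2) : Sym2 (Fin 4)) = s(2, 3) := Sym2.eq_swap
  simp [Fin.forall_fin_succ] at s₀ s₁ s₂ s₃ t₀ t₁ t₂ t₃
  simp only [e10, e20, e30, e21, e31, e32] at s₁ s₂ s₃ t₀ t₁ t₂ t₃
  -- Of the eight selections, four are stars and four are triangles.
  rcases k₁ with k₁ | k₁ <;> rcases k₂ with k₂ | k₂ <;> rcases k₃ with k₃ | k₃ <;>
    first
    | exact s₀ ‹_› ‹_› ‹_› | exact s₁ ‹_› ‹_› ‹_› | exact s₂ ‹_› ‹_› ‹_› | exact s₃ ‹_› ‹_› ‹_›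
    | exact t₀ ‹_› ‹_› ‹_› ‹_› ‹_› ‹_› | exact t₁ ‹_› ‹_› ‹_› ‹_› ‹_› ‹_›
    | exact t₂ ‹_› ‹_› ‹_› ‹_› ‹_› ‹_› | exact t₃ ‹_› ‹_› ‹_› ‹_› ‹_› ‹_›

/-! ### Enlarging a conformal even cycle by ears -/

theorem IsCyc.disjoint_image {c : ℕ → V} {n : ℕ} (h : IsCyc G c n) {A B : Set ℕ}
    (hA : A ⊆ Iio n) (hB : B ⊆ Iio n) (hAB : ∀ t ∈ A, t ∉ B) : Disjoint (c '' A) (c '' B) := by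
  rw [Set.disjoint_left]
  rintro _ ⟨s, hs, rfl⟩ ⟨t, ht, hst⟩
  exact hAB s hs (h.inj (hB ht) (hA hs) hst ▸ ht)

/-- An arc of even length together with an ear of odd length on its ends is an odd cycle. -/
theorem IsCyc.exists_odd {c : ℕ → V} {n : ℕ} (h : IsCyc G c n) {i j : ℕ} (hij : i < j)
    (hj : j ≤ n) (h' : 0 < i ∨ j < n) (he : Even (j - i)) {l : ℕ} {I : Set V}
    (hI : HasPath G (c i) (c j) l I) (hl : Odd l) (hd : Disjoint I (c '' Iio n)) :
    ∃ d k, Odd k ∧ IsCyc G d k ∧ d '' Iio k = c '' Icc i j ∪ I := by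
  have hsub : c '' Ioo i j ⊆ c '' Iio n := image_mono fun t ht => ht.2.trans_le hj
  obtain ⟨d, hd', himg⟩ := (h.hasPath hij hj h').exists_isCyc hI.reverse
    (hd.mono_right hsub).symm (by omega) hl.pos.ne'
  refine ⟨d, _, he.add_odd hl, hd', ?_⟩
  rw [himg, ← Ioo_union_both hij.le, image_union, image_pair, union_comm (c '' Ioo i j)]

/-- The complement of the cycle on `A` and `I` is covered by the cycle on `B` and `J`, the matched
leftover arcs `P`, and the matched outside. -/
theorem IsBN.false_of_odd_cycles [Fintype V] (hBN : IsBN G) {c : ℕ → V} {n : ℕ} (h : IsCyc G c n)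
    {A B P : Set ℕ} (hABP : ∀ t, t < n ↔ t ∈ A ∨ t ∈ B ∨ t ∈ P)
    (hAB : ∀ t ∈ A, t ∉ B) (hAP : ∀ t ∈ A, t ∉ P) (hBP : ∀ t ∈ B, t ∉ P) {I J : Set V}
    (hI : Disjoint I (c '' Iio n)) (hJ : Disjoint J (c '' Iio n)) (hIJ : Disjoint I J)
    (cA : ∃ d k, Odd k ∧ IsCyc G d k ∧ d '' Iio k = c '' A ∪ I)
    (cB : ∃ d k, Odd k ∧ IsCyc G d k ∧ d '' Iio k = c '' B ∪ J)
    (hP : MatchableOn G (c '' P)) (hm : MatchableOn G (c '' Iio n ∪ I ∪ J)ᶜ) : False := by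
  obtain ⟨d, k, hk, hd, hdA⟩ := cA
  obtain ⟨d', k', -, hd', hdB⟩ := cB
  have hAn : A ⊆ Iio n := fun t ht => (hABP t).2 (Or.inl ht)
  have hBn : B ⊆ Iio n := fun t ht => (hABP t).2 (Or.inr (Or.inl ht))
  have hPn : P ⊆ Iio n := fun t ht => (hABP t).2 (Or.inr (Or.inr ht))
  have hn : c '' Iio n = c '' A ∪ c '' B ∪ c '' P := by
    rw [← image_union, ← image_union]
    congr 1
    ext t
    simp only [mem_Iio, hABP, mem_union, or_assoc]
  have dAB : Disjoint (c '' A) (c '' B) :=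
    h.disjoint_image hAn hBn hAB
  have dAP : Disjoint (c '' A) (c '' P) :=
    h.disjoint_image hAn hPn hAP
  have dBP : Disjoint (c '' B) (c '' P) :=
    h.disjoint_image hBn hPn hBP
  rw [hn, Set.disjoint_union_right, Set.disjoint_union_right] at hI hJ
  have hcov : CycleCoverable G ((c '' B ∪ J) ∪ c '' P ∪ (c '' Iio n ∪ I ∪ J)ᶜ) := by
    refine (CycleCoverable.union (hdB ▸ hd'.cycleCoverable) hP.cycleCoverable ?_).union
      hm.cycleCoverable ?_
    · exact Set.disjoint_union_left.2 ⟨dBP, hJ.2⟩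
    · rw [hn]
      refine disjoint_compl_right.mono_left ?_
      intro x hx
      simp only [mem_union] at hx ⊢
      tauto
  refine hBN.not_odd_of_cycleCoverable hd hk ?_
  convert hcov using 1
  rw [hdA, hn]
  have dA : ∀ x, x ∈ c '' A ∪ I → x ∉ c '' B ∪ J ∪ c '' P := by
    rintro x (hx | hx) ((hx' | hx') | hx')
    · exact Set.disjoint_left.1 dAB hx hx'
    · exact Set.disjoint_left.1 hJ.1.1 hx' hx
    · exact Set.disjoint_left.1 dAP hx hx'
    · exact Set.disjoint_left.1 hI.1.2 hx hx'
    · exact Set.disjoint_left.1 hIJ hx hx'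
    · exact Set.disjoint_left.1 hI.2 hx hx'
  ext x
  have := dA x
  simp only [mem_union, mem_compl_iff] at this ⊢
  clear dA
  by_cases h1 : x ∈ c '' A
  · simp_all
  by_cases h2 : x ∈ I
  · simp_all
  simp only [h1, h2, false_or, or_false, not_false_eq_true, true_iff]
  by_cases h3 : x ∈ c '' B
  · simp [h3]
  by_cases h4 : x ∈ J
  · simp [h4]
  by_cases h5 : x ∈ c '' P
  · simp [h5]
  · simp [h3, h4, h5]

theorem IsCyc.matchableOn_arc {c : ℕ → V} {n : ℕ} (h : IsCyc G c n) {i j : ℕ} (hij : i < j)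
    (hj : j ≤ n) (h' : 0 < i ∨ j < n) (ho : Odd (j - i)) : MatchableOn G (c '' Ioo i j) :=
  (h.hasPath hij hj h').matchableOn ho

/-- The label of the vertex with number `t` of a cycle whose branch vertices have numbers
`0 < i < j < k`. -/
def arcLabel (i j k t : ℕ) : Sym2 (Fin 4) :=
  if t = 0 then s(0, 0) else if t < i then s(0, 1) else
    if t = i then s(1, 1) else if t < j then s(1, 2) else if t = j then s(2, 2) else
    if t < k then s(2, 3) else if t = k then s(3, 3) else s(3, 0)

theorem arcLabel_spec {i j k : ℕ} (hi : 0 < i) (hij : i < j) (hjk : j < k) (t : ℕ) :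
    (t = 0 ∧ arcLabel i j k t = s(0, 0)) ∨ (0 < t ∧ t < i ∧ arcLabel i j k t = s(0, 1)) ∨
    (t = i ∧ arcLabel i j k t = s(1, 1)) ∨ (i < t ∧ t < j ∧ arcLabel i j k t = s(1, 2)) ∨
    (t = j ∧ arcLabel i j k t = s(2, 2)) ∨ (j < t ∧ t < k ∧ arcLabel i j k t = s(2, 3)) ∨
    (t = k ∧ arcLabel i j k t = s(3, 3)) ∨ (k < t ∧ arcLabel i j k t = s(3, 0)) := by
  unfold arcLabel
  split_ifs <;> simp only [and_true] <;> omega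

theorem arcLabel_eq_iff {i j k : ℕ} (hi : 0 < i) (hij : i < j) (hjk : j < k) (t : ℕ) :
    (arcLabel i j k t = s(0, 0) ↔ t = 0) ∧ (arcLabel i j k t = s(1, 1) ↔ t = i) ∧
    (arcLabel i j k t = s(2, 2) ↔ t = j) ∧ (arcLabel i j k t = s(3, 3) ↔ t = k) ∧
    (arcLabel i j k t = s(0, 1) ↔ 0 < t ∧ t < i) ∧ (arcLabel i j k t = s(1, 2) ↔ i < t ∧ t < j) ∧
    (arcLabel i j k t = s(2, 3) ↔ j < t ∧ t < k) ∧ (arcLabel i j k t = s(3, 0) ↔ k < t) ∧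
    arcLabel i j k t ≠ s(0, 2) ∧ arcLabel i j k t ≠ s(1, 3) := by
  rcases arcLabel_spec hi hij hjk t with ⟨h1, h⟩ | ⟨h1, h2, h⟩ | ⟨h1, h⟩ | ⟨h1, h2, h⟩ |
    ⟨h1, h⟩ | ⟨h1, h2, h⟩ | ⟨h1, h⟩ | ⟨h1, h⟩ <;> rw [h] <;> simp <;> omega

/-- A cycle with two crossing ears is a bisubdivision of `K₄`. -/
theorem IsCyc.exists_k4Frame {c : ℕ → V} {n : ℕ} (h : IsCyc G c n) (hn : Even n) {i j k : ℕ}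
    (hi : 0 < i) (hij : i < j) (hjk : j < k) (hkn : k < n) (oi : Odd i) (ej : Even j) (ok : Odd k)
    {I J : Set V} {l l' : ℕ} (hl : Odd l) (hl' : Odd l') (hI : HasPath G (c 0) (c j) l I)
    (hJ : HasPath G (c i) (c k) l' J) (dI : Disjoint I (c '' Iio n))
    (dJ : Disjoint J (c '' Iio n)) (dIJ : Disjoint I J)
    (hm : MatchableOn G (c '' Iio n ∪ I ∪ J)ᶜ) :
    ∃ f lab, K4Frame G f lab ∧ {x | lab x ≠ none} = c '' Iio n ∪ I ∪ J := by
  classical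
  set g := arcLabel i j k
  have hg := arcLabel_eq_iff hi hij hjk
  set lab : V → Option (Sym2 (Fin 4)) := fun x => if x ∈ I then some s(0, 2) else
    if x ∈ J then some s(1, 3) else
    if x ∈ c '' Iio n then some (g (Function.invFunOn c (Iio n) x)) else none with hlab
  have hinv : ∀ t < n, Function.invFunOn c (Iio n) (c t) = t := fun t ht => by
    have h1 : ∃ s ∈ Iio n, c s = c t := ⟨t, ht, rfl⟩
    exact h.inj (Function.invFunOn_mem h1) ht (Function.invFunOn_eq h1)
  have lI : ∀ x ∈ I, lab x = some s(0, 2) := fun x hx => by simp only [hlab, hx, if_true]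
  have lJ : ∀ x ∈ J, lab x = some s(1, 3) := fun x hx => by
    simp only [hlab, hx, if_true, Set.disjoint_right.1 dIJ hx, if_false]
  have lc : ∀ t < n, lab (c t) = some (g t) := fun t ht => by
    have hmem : c t ∈ c '' Iio n := ⟨t, ht, rfl⟩
    simp only [hlab, Set.disjoint_right.1 dI hmem,
      Set.disjoint_right.1 dJ hmem, hmem, hinv t ht, if_true, if_false]
  have lnone : ∀ x, x ∉ I → x ∉ J → x ∉ c '' Iio n → lab x = none := fun x h1 h2 h3 => by
    simp only [hlab, h1, h2, h3, if_false]
  have hcases : ∀ x, x ∈ I ∨ x ∈ J ∨ (∃ t < n, c t = x) ∨ (x ∉ I ∧ x ∉ J ∧ x ∉ c '' Iio n) := by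
    intro x
    have : x ∈ c '' Iio n ↔ ∃ t < n, c t = x := Iff.rfl
    tauto
  have gne : ∀ t, g t ≠ s(0, 2) ∧ g t ≠ s(1, 3) := fun t => (hg t).2.2.2.2.2.2.2.2
  have sI : {x | lab x = some s(0, 2)} = I := by
    ext x
    refine ⟨fun hx => ?_, lI x⟩
    replace hx : lab x = some s(0, 2) := hx
    rcases hcases x with h1 | h1 | ⟨t, ht, rfl⟩ | ⟨h1, h2, h3⟩
    · exact h1
    · rw [lJ x h1] at hx
      exact absurd (Option.some_inj.1 hx) (by decide)
    · rw [lc t ht] at hx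
      exact absurd (Option.some_inj.1 hx) (gne t).1
    · rw [lnone x h1 h2 h3] at hx
      simp at hx
  have sJ : {x | lab x = some s(1, 3)} = J := by
    ext x
    refine ⟨fun hx => ?_, lJ x⟩
    replace hx : lab x = some s(1, 3) := hx
    rcases hcases x with h1 | h1 | ⟨t, ht, rfl⟩ | ⟨h1, h2, h3⟩
    · rw [lI x h1] at hx
      exact absurd (Option.some_inj.1 hx) (by decide)
    · exact h1
    · rw [lc t ht] at hx
      exact absurd (Option.some_inj.1 hx) (gne t).2
    · rw [lnone x h1 h2 h3] at hx
      simp at hx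
  have sc : ∀ e : Sym2 (Fin 4), e ≠ s(0, 2) → e ≠ s(1, 3) → ∀ A : Set ℕ,
      (∀ t < n, g t = e ↔ t ∈ A) → A ⊆ Iio n → {x | lab x = some e} = c '' A := by
    intro e he1 he2 A hA hAn
    ext x
    change lab x = some e ↔ _
    constructor
    · intro hx
      rcases hcases x with h1 | h1 | ⟨t, ht, rfl⟩ | ⟨h1, h2, h3⟩
      · rw [lI x h1] at hx
        exact absurd (Option.some_inj.1 hx).symm he1
      · rw [lJ x h1] at hx
        exact absurd (Option.some_inj.1 hx).symm he2
      · rw [lc t ht] at hx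
        exact ⟨t, (hA t ht).1 (Option.some_inj.1 hx), rfl⟩
      · rw [lnone x h1 h2 h3] at hx
        simp at hx
    · rintro ⟨t, ht, rfl⟩
      rw [lc t (hAn ht), (hA t (hAn ht)).2 ht]
  have s01 : {x | lab x = some s(0, 1)} = c '' Ioo 0 i :=
    sc _ (by decide) (by decide) _ (fun t ht => (hg t).2.2.2.2.1) fun t ht => by
      simp only [mem_Ioo, mem_Iio] at *; omega
  have s12 : {x | lab x = some s(1, 2)} = c '' Ioo i j :=
    sc _ (by decide) (by decide) _ (fun t ht => (hg t).2.2.2.2.2.1) fun t ht => by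
      simp only [mem_Ioo, mem_Iio] at *; omega
  have s23 : {x | lab x = some s(2, 3)} = c '' Ioo j k :=
    sc _ (by decide) (by decide) _ (fun t ht => (hg t).2.2.2.2.2.2.1) fun t ht => by
      simp only [mem_Ioo, mem_Iio] at *; omega
  have s30 : {x | lab x = some s(3, 0)} = c '' Ioo k n :=
    sc _ (by decide) (by decide) _ (fun t ht => (hg t).2.2.2.2.2.2.2.1.trans (by simp [ht])) fun t ht => by
      simp only [mem_Ioo, mem_Iio] at *; omega
  have hvert : ∀ w : Fin 4, ∀ p < n, (∀ t, g t = s(w, w) ↔ t = p) →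
      ∀ x, lab x = some s(w, w) ↔ x = c p := by
    intro w p hp hw x
    have h1 : ∀ w : Fin 4, s(w, w) ≠ s(0, 2) ∧ s(w, w) ≠ s(1, 3) := by decide
    have := sc s(w, w) (h1 w).1 (h1 w).2 {p} (fun t _ => hw t) (by simpa)
    rw [image_singleton] at this
    exact Set.ext_iff.1 this x
  -- The four arcs are the paths 01, 12, 23, 30, all odd by the parities of `i`, `j`, `k`, `n`; the
  -- ears are the diagonals 02 and 13.
  let f : Fin 4 → V := ![c 0, c i, c j, c k]
  let Q : Fin 4 → Fin 4 → Prop := fun u v =>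
    ∃ m, Odd m ∧ HasPath G (f u) (f v) m {x | lab x = some s(u, v)}
  have sym : ∀ u v, Q u v → Q v u := by
    rintro u v ⟨m, hm, hp⟩
    exact ⟨m, hm, by rw [Sym2.eq_swap]; exact hp.reverse⟩
  have q01 : Q 0 1 := ⟨i - 0, by simpa, by
    rw [s01]; exact h.hasPath hi (by omega) (by omega)⟩
  have q12 : Q 1 2 := ⟨j - i, Nat.Even.sub_odd hij.le ej oi, by
    rw [s12]; exact h.hasPath hij (by omega) (by omega)⟩
  have q23 : Q 2 3 := ⟨k - j, Nat.Odd.sub_even hjk.le ok ej, by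
    rw [s23]; exact h.hasPath hjk (by omega) (by omega)⟩
  have q30 : Q 3 0 := ⟨n - k, Nat.Even.sub_odd hkn.le hn ok, by
    rw [s30]
    have := h.hasPath hkn le_rfl (by omega)
    rwa [h.closed] at this⟩
  have q02 : Q 0 2 := ⟨l, hl, by rw [sI]; exact hI⟩
  have q13 : Q 1 3 := ⟨l', hl', by rw [sJ]; exact hJ⟩
  have hnone : ∀ x, lab x ≠ none ↔ x ∈ c '' Iio n ∪ I ∪ J := by
    intro x
    simp only [mem_union]
    rcases hcases x with h1 | h1 | ⟨t, ht, rfl⟩ | ⟨h1, h2, h3⟩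
    · exact iff_of_true (by rw [lI x h1]; exact Option.some_ne_none _) (Or.inl (Or.inr h1))
    · exact iff_of_true (by rw [lJ x h1]; exact Option.some_ne_none _) (Or.inr h1)
    · exact iff_of_true (by rw [lc t ht]; exact Option.some_ne_none _) (Or.inl (Or.inl ⟨t, ht, rfl⟩))
    · exact iff_of_false (not_not.2 (lnone x h1 h2 h3)) (by tauto)
  refine ⟨f, lab, ⟨?_, ?_, ?_⟩, Set.ext hnone⟩
  · intro w
    fin_cases w
    · exact hvert 0 0 (by omega) fun t => (hg t).1
    · exact hvert 1 i (by omega) fun t => (hg t).2.1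
    · exact hvert 2 j (by omega) fun t => (hg t).2.2.1
    · exact hvert 3 k (by omega) fun t => (hg t).2.2.2.1
  · intro u v huv
    fin_cases u <;> fin_cases v <;>
      first
      | exact absurd rfl huv | exact q01 | exact q02 | exact sym _ _ q30 | exact sym _ _ q01
      | exact q12 | exact q13 | exact sym _ _ q02 | exact sym _ _ q12 | exact q23 | exact q30
      | exact sym _ _ q13 | exact sym _ _ q23
  · convert hm using 1
    ext x
    rw [mem_compl_iff, ← hnone]
    simp

theorem ncard_even_eq_ncard_odd (n : ℕ) (hn : Even n) :
    {t | t < n ∧ Even t}.ncard = {t | t < n ∧ Odd t}.ncard := by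
  have : {t | t < n ∧ Odd t} = (· + 1) '' {t | t < n ∧ Even t} := by
    ext t
    constructor
    · rintro ⟨h1, k, rfl⟩
      exact ⟨2 * k, ⟨by omega, by simp⟩, rfl⟩
    · rintro ⟨s, ⟨h1, k, rfl⟩, rfl⟩
      obtain ⟨m, rfl⟩ := hn
      dsimp only
      exact ⟨by omega, k, by omega⟩
  rw [this, Set.ncard_image_of_injective _ (add_left_injective 1)]

/-- Two disjoint ears with ends `0, j` and `i, k`, where `j` is even and `i`, `k` are odd: the cycle
can be enlarged. -/
theorem IsCyc.evenCycleOn_of_two_ears [Fintype V] (hBN : IsBN G)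
    (hD1 : ¬ IsConformalMinor graphD1 G) (hD2 : ¬ IsConformalMinor graphD2 G)
    {c : ℕ → V} {n : ℕ} (h : IsCyc G c n) (hn : Even n) {i j k : ℕ} (hj0 : 0 < j) (hjn : j < n)
    (hik : i < k) (hkn : k < n) (oi : Odd i) (ej : Even j) (ok : Odd k)
    {I J : Set V} {l l' : ℕ} (hl : Odd l) (hl' : Odd l') (hI : HasPath G (c 0) (c j) l I)
    (hJ : HasPath G (c i) (c k) l' J) (dI : Disjoint I (c '' Iio n))
    (dJ : Disjoint J (c '' Iio n)) (dIJ : Disjoint I J)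
    (hm : MatchableOn G (c '' Iio n ∪ I ∪ J)ᶜ) : EvenCycleOn G (c '' Iio n ∪ I ∪ J) := by
  have hij : i ≠ j := by
    rintro rfl
    exact Nat.not_even_iff_odd.2 oi ej
  have hkj : k ≠ j := by
    rintro rfl
    exact Nat.not_even_iff_odd.2 ok ej
  have hi0 := oi.pos
  have cJ := h.exists_odd hik hkn.le (Or.inr hkn) (Nat.Odd.sub_odd ok oi) hJ hl' dJ
  rcases lt_or_gt_of_ne hij with hij | hij
  · rcases lt_or_gt_of_ne hkj with hkj | hkj
    · exfalso
      -- The second ear lies between `0` and `j`, so the first one is closed by the other arc, from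
      -- `j` to `n`. Position `n` is position `0` again, which is why it is replaced below.
      have cI := h.exists_odd hjn le_rfl (Or.inl hj0) (hn.tsub ej)
        (I := I) (l := l) (by rw [h.closed]; exact hI.reverse) hl dI
      have himg : c '' Icc j n = c '' (Ico j n ∪ {0}) := by
        rw [← Ico_union_right hjn.le, image_union, image_union, image_singleton, image_singleton,
          h.closed]
      rw [himg] at cI
      refine hBN.false_of_odd_cycles h (P := Ioo 0 i ∪ Ioo k j) ?_ ?_ ?_ ?_ dI dJ dIJ cI cJ ?_ hm
      · intro t; simp only [mem_union, mem_Ico, mem_singleton_iff, mem_Icc, mem_Ioo]; omega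
      · intro t; simp only [mem_union, mem_Ico, mem_singleton_iff, mem_Icc]; omega
      · intro t; simp only [mem_union, mem_Ico, mem_singleton_iff, mem_Ioo]; omega
      · intro t; simp only [mem_union, mem_Icc, mem_Ioo]; omega
      · rw [image_union]
        refine (h.matchableOn_arc oi.pos (by omega) (by omega) (by simpa)).union
          (h.matchableOn_arc hkj (by omega) (by omega) (Nat.Even.sub_odd hkj.le ej ok)) ?_
        refine h.disjoint_image ?_ ?_ ?_ <;> intro t <;> simp only [mem_Ioo, mem_Iio] <;> omega
    -- The only crossing case, `i < j < k`.
    · obtain ⟨f, lab, hf, hlab⟩ := h.exists_k4Frame hn oi.pos hij hkj hkn oi ej ok hl hl' hI hJ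
        dI dJ dIJ hm
      exact hlab ▸ hf.evenCycleOn hD1 hD2
  -- Now `j < i < k`: both ears close up with their short arcs, and the two leftover arcs have odd
  -- length, so their interiors are matchable.
  · exfalso
    have cI := h.exists_odd hj0 hjn.le (Or.inr hjn) (by simpa) hI hl dI
    refine hBN.false_of_odd_cycles h (P := Ioo j i ∪ Ioo k n) ?_ ?_ ?_ ?_ dI dJ dIJ cI cJ ?_ hm
    · intro t; simp only [mem_union, mem_Icc, mem_Ioo]; omega
    · intro t; simp only [mem_Icc]; omega
    · intro t; simp only [mem_union, mem_Icc, mem_Ioo]; omega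
    · intro t; simp only [mem_union, mem_Icc, mem_Ioo]; omega
    · rw [image_union]
      refine (h.matchableOn_arc hij (by omega) (by omega) (Nat.Odd.sub_even hij.le oi ej)).union
        (h.matchableOn_arc hkn (by omega) (by omega) (Nat.Even.sub_odd hkn.le hn ok)) ?_
      refine h.disjoint_image ?_ ?_ ?_ <;> intro t <;> simp only [mem_Ioo, mem_Iio] <;> omega

/-- An ear with ends `0` and `j`, where `j` is odd: the cycle can be enlarged. -/
theorem IsCyc.evenCycleOn_of_ear (hA1 : ¬ IsConformalMinor graphA1 G) {c : ℕ → V} {n : ℕ}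
    (h : IsCyc G c n) (hn : Even n) {j : ℕ} (hjn : j < n) (oj : Odd j) {I : Set V} {l : ℕ}
    (hl : Odd l) (hI : HasPath G (c 0) (c j) l I) (dI : Disjoint I (c '' Iio n))
    (hne : I.Nonempty) (hm : MatchableOn G (c '' Iio n ∪ I)ᶜ) :
    EvenCycleOn G (c '' Iio n ∪ I) := by
  have p₁ := h.hasPath oj.pos hjn.le (Or.inr hjn)
  have p₂ := h.hasPath hjn le_rfl (Or.inl oj.pos)
  rw [h.closed] at p₂
  have hset : c '' Iio n ∪ I = {c 0, c j} ∪ I ∪ c '' Ioo 0 j ∪ c '' Ioo j n := by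
    have : Iio n = {0, j} ∪ Ioo 0 j ∪ Ioo j n := by
      ext t
      simp only [mem_Iio, mem_union, mem_insert_iff, mem_singleton_iff, mem_Ioo]
      omega
    rw [this, image_union, image_union, image_pair]
    ext x
    simp only [mem_union]
    tauto
  rw [hset] at hm ⊢
  refine evenCycleOn_of_theta hI p₁ p₂.reverse hl (by simpa) (Nat.Even.sub_odd hjn.le hn oj)
    (dI.mono_right (image_mono fun t ht => ht.2.trans hjn))
    (dI.mono_right (image_mono fun t ht => ht.2)) ?_ ?_ hne hm hA1
  · refine h.disjoint_image ?_ ?_ ?_ <;> intro t <;> simp only [mem_Ioo, mem_Iio] <;> omega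
  · intro he
    have := h.inj (mem_Iio.2 (by omega)) hjn he
    have := oj.pos
    omega

/-- Matching coveredness supplies a perfect matching through an edge leaving `S`; the ear it starts
has inner vertices, so the set really grows. -/
theorem exists_larger_evenCycleOn [Fintype V] (hmc : IsMatchingCovered G) (hBN : IsBN G)
    (hA1 : ¬ IsConformalMinor graphA1 G) (hD1 : ¬ IsConformalMinor graphD1 G)
    (hD2 : ¬ IsConformalMinor graphD2 G) {S : Set V} (hS : EvenCycleOn G S)
    (hm : MatchableOn G Sᶜ) (hne : S ≠ univ) :
    ∃ S', S ⊂ S' ∧ EvenCycleOn G S' ∧ MatchableOn G S'ᶜ := by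
  obtain ⟨c₀, N, hc₀, hN, eN, rfl⟩ := hS
  obtain ⟨z, hz⟩ := (ne_univ_iff_exists_notMem _).1 hne
  obtain ⟨p⟩ := hmc.1.preconnected (c₀ 0) z
  obtain ⟨⟨⟨x, y⟩, hxy⟩, -, hx, hy⟩ := p.exists_boundary_dart (c₀ '' Iio N) ⟨0, hN, rfl⟩ hz
  obtain ⟨a, ha, rfl⟩ := hx
  simp only [mem_Iio] at ha hxy hy
  obtain ⟨n, hnx, hn⟩ := hmc.exists_involution hxy
  -- The cycle is rotated so that the ear starts at position `0`; then only the position `j` of its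
  -- other end matters.
  have hc := hc₀.rotate ha
  have hx0 : c₀ a = (fun i => c₀ ((i + a) % N)) 0 := by simp [Nat.mod_eq_of_lt ha]
  rw [hx0] at hnx
  rw [← IsCyc.image_rotate ha] at hm hy ⊢
  generalize (fun i => c₀ ((i + a) % N)) = c at *
  clear hx0 hxy hc₀ hne hz p
  obtain ⟨m, hm⟩ := hm
  have h0 : c 0 ∈ c '' Iio N := ⟨0, hN, rfl⟩
  have hm' : ∀ T, (∀ v ∈ T, m v ∈ T) → (∀ v ∈ T, v ∉ c '' Iio N) →
      MatchableOn G (c '' Iio N ∪ T)ᶜ := by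
    intro T hT hTS
    refine MatchableOn.of_involution (fun v hv => (hm v hv).2) (fun v hv hv' => hv (Or.inl hv')) ?_
    intro v hv hv'
    have hvS : v ∈ (c '' Iio N)ᶜ := fun hv' => hv (Or.inl hv')
    rcases hv' with hv' | hv'
    · exact (hm v hvS).1 hv'
    · have := hT _ hv'
      rw [(hm v hvS).2.2] at this
      exact hv (Or.inr this)
  have hlarger : ∀ T : Set V, T.Nonempty → (∀ v ∈ T, v ∉ c '' Iio N) →
      c '' Iio N ⊂ c '' Iio N ∪ T := by
    rintro T ⟨v, hv⟩ hT
    exact ⟨subset_union_left, fun h => hT v hv (h (Or.inr hv))⟩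
  obtain ⟨w, I, hI⟩ := exists_isEar hn (c '' Iio N) hm h0
  have hIne : I.Nonempty := hI.nonempty (hnx ▸ hy) h0
  obtain ⟨j, hj, rfl⟩ := hI.right_mem
  simp only [mem_Iio] at hj
  obtain ⟨l, hl, hp⟩ := hI.path
  have hIS : ∀ v ∈ I, v ∉ c '' Iio N := fun v hv => Set.disjoint_left.1 hI.disjoint hv
  rcases Nat.even_or_odd j with ej | oj
  swap
  · have hmI := hm' I hI.inner_closed hIS
    exact ⟨_, hlarger I hIne hIS,
      hc.evenCycleOn_of_ear hA1 eN hj oj hl hp hI.disjoint hIne hmI, hmI⟩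
  have hj0 : 0 < j := Nat.pos_of_ne_zero fun h => hI.ne (by rw [h])
  -- Both ends of the ear are at even positions. Equality of the two classes forces a second ear
  -- between odd positions.
  have hcard : (c '' {t | t < N ∧ Even t}).ncard = (c '' {t | t < N ∧ Odd t}).ncard := by
    rw [(hc.inj.mono fun t ht => ht.1).ncard_image, (hc.inj.mono fun t ht => ht.1).ncard_image,
      ncard_even_eq_ncard_odd N eN]
  obtain ⟨x', w', J, ⟨i, ⟨hi, oi⟩, rfl⟩, ⟨k, ⟨hk, ok⟩, rfl⟩, hJ, hdis⟩ :=
    exists_isEar_of_ncard_eq hn hm (by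
      rw [← image_union]
      congr 1
      ext t
      have := Nat.even_or_odd t
      simp only [mem_union, mem_Iio]
      change (t < N ∧ Even t) ∨ (t < N ∧ Odd t) ↔ _
      tauto)
    (hc.disjoint_image (fun t ht => ht.1) (fun t ht => ht.1)
      fun t ht ht' => Nat.not_even_iff_odd.2 ht'.2 ht.2) hcard
    ⟨0, ⟨hN, Even.zero⟩, rfl⟩ ⟨j, ⟨hj, ej⟩, rfl⟩ hI
  have hJS : ∀ v ∈ J, v ∉ c '' Iio N := fun v hv => Set.disjoint_left.1 hJ.disjoint hv
  have dIJ : Disjoint I J := hdis.mono ((subset_insert _ _).trans (subset_insert _ _))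
    ((subset_insert _ _).trans (subset_insert _ _))
  have hmIJ := hm' (I ∪ J)
    (fun v hv => hv.imp (hI.inner_closed v) (hJ.inner_closed v))
    (fun v hv => hv.elim (hIS v) (hJS v))
  have hlt := hlarger (I ∪ J) (hIne.mono subset_union_left) fun v hv => hv.elim (hIS v) (hJS v)
  rw [← union_assoc] at hmIJ hlt
  refine ⟨_, hlt, ?_, hmIJ⟩
  obtain ⟨l', hl', hp'⟩ := hJ.path
  have hik : i ≠ k := by
    rintro rfl
    exact hJ.ne rfl
  rcases lt_or_gt_of_ne hik with hik | hik
  · exact hc.evenCycleOn_of_two_ears hBN hD1 hD2 eN hj0 hj hik hk oi ej ok hl hl' hp hp'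
      hI.disjoint hJ.disjoint dIJ hmIJ
  · exact hc.evenCycleOn_of_two_ears hBN hD1 hD2 eN hj0 hj hik hi ok ej oi hl hl' hp hp'.reverse
      hI.disjoint hJ.disjoint dIJ hmIJ

/-! ### The starting edge and the maximal conformal even cycle. -/

theorem evenCycleOn_pair {a b : V} (h : G.Adj a b) : EvenCycleOn G {a, b} := by
  have := (HasPath.single h).evenCycleOn (HasPath.single h.symm) one_ne_zero one_ne_zero even_two
    (disjoint_empty _)
  simpa using this

end BNGraph

theorem lemma4p6 {V : Type*} [Fintype V] [DecidableEq V] (G : SimpleGraph V)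
    (hnb : ¬ G.IsBipartite)
    (hmc : BNGraph.IsMatchingCovered G)
    (hBN : BNGraph.IsBN G)
    (hA1 : ¬ BNGraph.IsConformalMinor BNGraph.graphA1 G)
    (hD1 : ¬ BNGraph.IsConformalMinor BNGraph.graphD1 G)
    (hD2 : ¬ BNGraph.IsConformalMinor BNGraph.graphD2 G) :
    ∃ (a : V) (C : G.Walk a a), C.IsHamiltonianCycle := by
  obtain ⟨M, hM⟩ := hBN.1
  obtain ⟨m, -, hm⟩ := BNGraph.exists_involution_of_isPerfectMatching hM
  obtain ⟨v⟩ := hmc.1.nonempty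
  have hstart : BNGraph.EvenCycleOn G {v, m v} ∧ BNGraph.MatchableOn G ({v, m v} : Set V)ᶜ := by
    refine ⟨BNGraph.evenCycleOn_pair (hm v).1,
      BNGraph.MatchableOn.of_involution (S := Set.univ) (fun u _ => hm u) (Set.subset_univ _) ?_⟩
    rintro u hu (h | h)
    · exact hu (Or.inr (by rw [← h, (hm u).2]; rfl))
    · exact hu (Or.inl (by rw [← (hm u).2, h, (hm v).2]))
  obtain ⟨S, -, ⟨hS, hSm⟩, hmax⟩ := Finite.exists_le_maximal
    (p := fun S : Set V => BNGraph.EvenCycleOn G S ∧ BNGraph.MatchableOn G Sᶜ) hstart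
  have hSu : S = Set.univ := by
    by_contra hne
    obtain ⟨S', hlt, h1, h2⟩ := BNGraph.exists_larger_evenCycleOn hmc hBN hA1 hD1 hD2 hS hSm hne
    exact hlt.2 (hmax ⟨h1, h2⟩ hlt.1)
  obtain ⟨c, n, hc, hn, en, himg⟩ := hS
  rw [hSu] at himg
  refine hc.exists_isHamiltonianCycle ?_ himg
  by_contra hlt
  -- A spanning cycle of length two means that the graph has only two vertices, which contradicts
  -- nonbipartiteness.
  obtain rfl : n = 2 := by
    obtain ⟨k, rfl⟩ := en
    omega
  have hV : ∀ u, u = c 0 ∨ u = c 1 := by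
    intro u
    obtain ⟨t, ht, rfl⟩ : u ∈ c '' Set.Iio 2 := himg ▸ Set.mem_univ u
    simp only [Set.mem_Iio] at ht
    interval_cases t <;> simp
  refine hnb ⟨SimpleGraph.Coloring.mk (fun u => if u = c 0 then (0 : Fin 2) else 1) ?_⟩
  intro a b hab
  have := hab.ne
  rcases hV a with rfl | rfl <;> rcases hV b with rfl | rfl
  · exact absurd rfl this
  · simp [this.symm]
  · simp [this]
  · exact absurd rfl this
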